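/- All graphs are undirected and simple, and are regarded as structures with one binary relation $E$ (adjacency). For $n\ge 4$ let $D_n$ be the graph with the $2n+2$ vertices $v_1,v_2,a_1,\dots,a_n,b_1,\dots,b_n$ and the edges $v_1a_i,\ v_2b_i,\ a_ib_i$ $(1\le i\le n)$, $a_ia_{i+1},\ b_ib_{i+1},\ a_{i+1}b_i$ $(1\le i<n)$, and $a_1a_n,\ b_1b_n,\ a_1b_n$. Let $$\varphi=\exists x_1,x_2,y,z\,\bigl[E(x_1,y)\wedge E(y,z)\wedge E(z,x_2)\wedge\forall a,b\,\bigl(E(x_1,a)\wedge E(a,b)\wedge E(b,x_2)\to\exists c,d\ \chi\bigr)\bigr],$$ $$\chi=E(x_1,c)\wedge E(a,c)\wedge E(b,c)\wedge E(b,d)\wedge E(c,d)\wedge E(d,x_2),$$ and $\hat\varphi=\varphi\vee\exists x_1,x_2,x_3,x_4\bigwedge_{i\ne j}E(x_i,x_j)$. A class $\mathcal C$ of graphs has the homomorphism (resp. extension) preservation property if every first-order sentence whose truth is preserved by homomorphisms (resp. induced embeddings) between members of $\mathcal C$ has the same models in $\mathcal C$ as some existential-positive (resp. existential) sentence. A minimal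 induced model of a sentence in $\mathcal C$ is a member of $\mathcal C$ that satisfies it and none of whose proper induced subgraphs in $\mathcal C$ satisfies it. **Theorem.** The class of finite planar graphs does not have the homomorphism preservation property; consequently it does not have the extension preservation property either. More precisely: 1. $\hat\varphi$ is preserved by homomorphisms over the class of finite planar graphs, but is not equivalent over this class to any existential-positive sentence. 2. If $n\ge 4$ and $H$ is a graph that contains no $K_4$ as a subgraph and no $K_5$ as a minor, and there is a homomorphism $D_n\to H$, then $H$ contains an induced subgraph isomorphic to $D_m$ for some $m\ge 4$ with $m\mid n$. 3. Up to isomorphism, the minimal induced models of $\hat\varphi$ in the class of finite planar graphs are exactly $K_4$ and the graphs $D_n$ for $n\ge 4$; the graphs $D_n$, $n\ge 4$, are pairwise non-isomorphic, so there are infinitely many. -/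

import Mathlib

universe u

namespace PlanarHPP

open FirstOrder FirstOrder.Language

/-! ### Classes of graphs, first-order sentences and preservation -/

/-- A class of (undirected, simple) graphs. -/
abbrev GraphClass : Type (u + 1) := ∀ ⦃V : Type u⦄, SimpleGraph V → Prop

/-- `G ⊨ φ`, where `G` is seen as a structure with one binary relation, its adjacency relation. -/
def Models {V : Type u} (G : SimpleGraph V) (φ : Language.graph.Sentence) : Prop :=
  @Sentence.Realize Language.graph V G.structure φ

/-- `φ` is preserved by homomorphisms over the class `C`. -/
def PreservedByHoms (C : GraphClass.{u}) (φ : Language.graph.Sentence) : Prop :=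
  ∀ ⦃V W : Type u⦄ (G : SimpleGraph V) (H : SimpleGraph W),
    C G → C H → Nonempty (G →g H) → Models G φ → Models H φ

/-- `φ` is preserved by extensions, that is by (induced) embeddings, over the class `C`. -/
def PreservedByExtensions (C : GraphClass.{u}) (φ : Language.graph.Sentence) : Prop :=
  ∀ ⦃V W : Type u⦄ (G : SimpleGraph V) (H : SimpleGraph W),
    C G → C H → Nonempty (G ↪g H) → Models G φ → Models H φ

/-- `φ` and `ψ` have the same models in the class `C`. -/
def EquivalentOver (C : GraphClass.{u}) (φ ψ : Language.graph.Sentence) : Prop :=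
  ∀ ⦃V : Type u⦄ (G : SimpleGraph V), C G → (Models G φ ↔ Models G ψ)

/-- Existential-positive formulas: built from atomic formulas (equalities included) and the
constants true and false by conjunction, disjunction and existential quantification. -/
inductive IsExistentialPositive {L : Language} {α : Type} :
    ∀ {n : ℕ}, L.BoundedFormula α n → Prop
  | top {n : ℕ} : IsExistentialPositive (⊤ : L.BoundedFormula α n)
  | bot {n : ℕ} : IsExistentialPositive (⊥ : L.BoundedFormula α n)
  | atom {n : ℕ} {φ : L.BoundedFormula α n} (h : φ.IsAtomic) : IsExistentialPositive φ
  | inf {n : ℕ} {φ ψ : L.BoundedFormula α n} (hφ : IsExistentialPositive φ)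
      (hψ : IsExistentialPositive ψ) : IsExistentialPositive (φ ⊓ ψ)
  | sup {n : ℕ} {φ ψ : L.BoundedFormula α n} (hφ : IsExistentialPositive φ)
      (hψ : IsExistentialPositive ψ) : IsExistentialPositive (φ ⊔ ψ)
  | ex {n : ℕ} {φ : L.BoundedFormula α (n + 1)} (hφ : IsExistentialPositive φ) :
      IsExistentialPositive φ.ex

/-- The homomorphism preservation property of a class of graphs. -/
def HasHomPreservation (C : GraphClass.{u}) : Prop :=
  ∀ φ : Language.graph.Sentence, PreservedByHoms C φ →
    ∃ ψ : Language.graph.Sentence, IsExistentialPositive ψ ∧ EquivalentOver C φ ψ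

/-- The extension preservation property of a class of graphs. -/
def HasExtPreservation (C : GraphClass.{u}) : Prop :=
  ∀ φ : Language.graph.Sentence, PreservedByExtensions C φ →
    ∃ ψ : Language.graph.Sentence, BoundedFormula.IsExistential ψ ∧ EquivalentOver C φ ψ

/-- `G` is a minimal induced model of `φ` in the class `C`: it is a model of `φ` in `C`, and no
proper induced subgraph of `G` that lies in `C` is a model of `φ`. -/
def IsMinimalInducedModel (C : GraphClass.{u}) (φ : Language.graph.Sentence)
    {V : Type u} (G : SimpleGraph V) : Prop :=
  C G ∧ Models G φ ∧
    ∀ S : Set V, S ≠ Set.univ → C (G.induce S) → ¬ Models (G.induce S) φ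

/-! ### Planar graphs and minors -/

/-- The Euclidean plane. -/
abbrev Plane : Type := EuclideanSpace ℝ (Fin 2)

/-- A drawing of a graph in the plane without crossings: vertices are distinct points, every edge
is a simple arc joining its two ends, an arc meets vertices at its ends only, and two
different arcs meet at most in ends. -/
structure PlaneDrawing {V : Type u} (G : SimpleGraph V) where
  point : V → Plane
  arc : G.edgeSet → unitInterval → Plane
  point_injective : Function.Injective point
  arc_continuous : ∀ e : G.edgeSet, Continuous (arc e)
  arc_injective : ∀ e : G.edgeSet, Function.Injective (arc e)
  arc_ends : ∀ e : G.edgeSet, ∃ x y : V, (e : Sym2 V) = s(x, y) ∧ arc e 0 = point x ∧ arc e 1 = point y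
  arc_ne_point : ∀ e : G.edgeSet, ∀ t ∈ Set.Ioo (0 : unitInterval) 1, ∀ x, arc e t ≠ point x
  arc_disjoint : ∀ e e' : G.edgeSet, e ≠ e' → ∀ t ∈ Set.Ioo (0 : unitInterval) 1,
    ∀ t' ∈ Set.Ioo (0 : unitInterval) 1, arc e t ≠ arc e' t'

/-- The class of finite planar graphs. -/
def planarGraphs : GraphClass.{u} := fun V G => Finite V ∧ Nonempty (PlaneDrawing G)

/-- `K` is a minor of `G`: there are pairwise disjoint connected branch sets in `G`, one for every
vertex of `K`, with an edge of `G` between any two that belong to adjacent vertices of `K`. -/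
def IsMinor {W : Type*} {V : Type*} (K : SimpleGraph W) (G : SimpleGraph V) : Prop :=
  ∃ B : W → Set V, (∀ w, (G.induce (B w)).Connected) ∧
    (∀ w w', w ≠ w' → Disjoint (B w) (B w')) ∧
    ∀ w w', K.Adj w w' → ∃ x ∈ B w, ∃ y ∈ B w', G.Adj x y

/-! ### The graphs `D n` -/

/-- The vertices `v₁`, `v₂`, `a i`, `b i` of `D n`; the indices run over `0, …, n - 1`. -/
inductive DVertex (n : ℕ) : Type
  | v₁ : DVertex n
  | v₂ : DVertex n
  | a (i : Fin n) : DVertex n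
  | b (i : Fin n) : DVertex n

/-- The edges of `D n`, each in one direction. The last three are the edges that close up the
strip spanned by the others, between index `0` and index `n - 1`. -/
inductive DEdge (n : ℕ) : DVertex n → DVertex n → Prop
  | va (i : Fin n) : DEdge n .v₁ (.a i)
  | vb (i : Fin n) : DEdge n .v₂ (.b i)
  | ab (i : Fin n) : DEdge n (.a i) (.b i)
  | aa (i j : Fin n) (h : (j : ℕ) = i + 1) : DEdge n (.a i) (.a j)
  | bb (i j : Fin n) (h : (j : ℕ) = i + 1) : DEdge n (.b i) (.b j)
  | ba (i j : Fin n) (h : (j : ℕ) = i + 1) : DEdge n (.b i) (.a j)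
  | aa_close (i j : Fin n) (hi : (i : ℕ) = 0) (hj : (j : ℕ) + 1 = n) : DEdge n (.a i) (.a j)
  | bb_close (i j : Fin n) (hi : (i : ℕ) = 0) (hj : (j : ℕ) + 1 = n) : DEdge n (.b i) (.b j)
  | ab_close (i j : Fin n) (hi : (i : ℕ) = 0) (hj : (j : ℕ) + 1 = n) : DEdge n (.a i) (.b j)

/-- The graph `D n`. -/
def D (n : ℕ) : SimpleGraph (DVertex n) := SimpleGraph.fromRel (DEdge n)

/-! ### The witnessing sentence -/

/-- The atomic formula `E(xᵢ, xⱼ)` in the variables `x₀, …, x_{n-1}`. -/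
abbrev E {n : ℕ} (i j : Fin n) : Language.graph.BoundedFormula Empty n :=
  adj.boundedFormula₂ (Term.var (Sum.inr i)) (Term.var (Sum.inr j))

/-- The formula `χ(x₁, x₂, y₁, z₁, y₂, z₂)` for
`x₁ = x₀`, `x₂ = x₁`, `y₁ = x₄`, `z₁ = x₅`, `y₂ = x₆`, `z₂ = x₇`. -/
def chi : Language.graph.BoundedFormula Empty 8 :=
  E 0 6 ⊓ E 4 6 ⊓ E 5 6 ⊓ E 5 7 ⊓ E 6 7 ⊓ E 7 1

/-- The sentence
`∃ x₁ x₂ y z, E(x₁,y) ∧ E(y,z) ∧ E(z,x₂) ∧`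
`∀ a b, (E(x₁,a) ∧ E(a,b) ∧ E(b,x₂) → ∃ c d, χ(x₁,x₂,a,b,c,d))`. -/
def phi : Language.graph.Sentence :=
  ((E 0 2 ⊓ E 2 3 ⊓ E 3 1 ⊓
    ((E 0 4 ⊓ E 4 5 ⊓ E 5 1).imp chi.ex.ex).all.all :
      Language.graph.BoundedFormula Empty 4)).ex.ex.ex.ex

/-- The sentence `∃ x₁ x₂ x₃ x₄, ⋀_{i ≠ j} E(xᵢ, xⱼ)`. -/
def containsK4 : Language.graph.Sentence :=
  ((E 0 1 ⊓ E 0 2 ⊓ E 0 3 ⊓ E 1 2 ⊓ E 1 3 ⊓ E 2 3 :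
      Language.graph.BoundedFormula Empty 4)).ex.ex.ex.ex

/-- The sentence `φ̂ = φ ∨ (there is a copy of K₄)`. -/
def phiHat : Language.graph.Sentence := phi ⊔ containsK4

/-- The meaning of `φ`. -/
theorem models_phi {V : Type u} (G : SimpleGraph V) :
    Models G phi ↔ ∃ x₁ x₂ y z : V, G.Adj x₁ y ∧ G.Adj y z ∧ G.Adj z x₂ ∧
      ∀ a b, G.Adj x₁ a ∧ G.Adj a b ∧ G.Adj b x₂ →
        ∃ c d, G.Adj x₁ c ∧ G.Adj a c ∧ G.Adj b c ∧ G.Adj b d ∧ G.Adj c d ∧ G.Adj d x₂ := by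
  let _ := G.structure
  simp [Models, phi, chi, Sentence.Realize, Formula.Realize,
    BoundedFormula.realize_rel₂, Fin.snoc, and_assoc]
  exact Iff.rfl

/-- The meaning of `φ̂`. -/
theorem models_phiHat {V : Type u} (G : SimpleGraph V) :
    Models G phiHat ↔ Models G phi ∨ ∃ x₁ x₂ x₃ x₄ : V, G.Adj x₁ x₂ ∧ G.Adj x₁ x₃ ∧
      G.Adj x₁ x₄ ∧ G.Adj x₂ x₃ ∧ G.Adj x₂ x₄ ∧ G.Adj x₃ x₄ := by
  let _ := G.structure
  simp [Models, phi, phiHat, containsK4, chi, Sentence.Realize, Formula.Realize,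
    BoundedFormula.realize_rel₂, Fin.snoc, and_assoc]
  exact Iff.rfl

end PlanarHPP

/-!
Why the theorem is true.

*Planarity.* The only topological input is that a graph with a plane drawing has no `K₅` minor
(`PlaneDrawing.not_isMinor_top`). It follows from `exists_disjoint_edges_meet`: if five points of
the plane are joined pairwise by arbitrary curves, two curves without a common end meet. Indeed, for
two curves that do not meet, the direction from a point of the one to a point of the other has a
continuous logarithm on a square, whose changes along the sides add up to zero. Measured
against fixed logarithms of the ten directions between the five points, these changes become
integers, and the fifteen equations for the pairs of disjoint edges contradict each other modulo
two. Conversely, `planarGraphs_D` draws `D n` on a cylinder with its two ends collapsed, mapped to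
the plane by a Möbius map that sends a point off the drawing to infinity.

*Homomorphic images of `D n`.* Let `H` have no `K₄` and no `K₅` minor. The image of `D n` in `H`
consists of two vertices `x₁`, `x₂` and two periodic sequences `A`, `B` (`IsStrip`). The
neighbours `x₁, A (i+1), B i, B (i-1), A (i-1)` of `A i` form a cycle. If a connected set off this
wheel contains `x₂` and a neighbour of `A i`, then it is joined to `B i` and `B (i-1)`, so a third
attachment to the cycle would give a `K₅` minor (`IsStrip.wheel_separates`). Feeding in the short
paths of the strip through `x₂` shows that `A` and `B` are disjoint, that `A i` is adjacent to no
`A j`, `B j` but the expected ones, and that `A i = A j` forces the two passages through this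
vertex to continue alike. Hence both sequences have the same exact period `m`, and the image is an
induced copy of `D m` (`IsStrip.exists_embedding`). In the same way the cycle `A` separates `x₁`
from the rest, so that every path `x₁, a, b, x₂` of `H` runs along an edge `A i, B j`, and `H` is
a model of `φ` (`IsStrip.models_phi`).

*Models of `φ`.* In a finite model the choice of `c, d` for given `a, b` can be iterated until it
closes up, which gives a homomorphism from some `D n` (`exists_hom_of_models_phi`). With the
above, `φ̂` is preserved by homomorphisms between finite planar graphs, and every model contains a
`K₄` or an induced `D m`. No `D m` is a proper induced subgraph of `D n`, because each edge of
`D n` is in exactly two triangles, and triangles connect any two edges (`embedding_surjective`). So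
`K₄` and the `D n` are the minimal models. An existential or existential-positive sentence that
holds in a graph holds already on boundedly many of its vertices (`HasBoundedWitnesses`), while
the `D n` are minimal models of unbounded size. -/

universe v

namespace PlanarHPP

/-! ### Five points in the plane joined by ten curves -/

/-- A nowhere vanishing function on a simply connected space has a continuous logarithm. -/
theorem exists_continuous_log {X : Type*} [TopologicalSpace X] [SimplyConnectedSpace X]
    [LocallyPathConnectedSpace X] {f : X → ℂ} (hf : Continuous f) (h0 : ∀ x, f x ≠ 0) :
    ∃ g : X → ℂ, Continuous g ∧ ∀ x, Complex.exp (g x) = f x := by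
  obtain ⟨x₀⟩ : Nonempty X := inferInstance
  obtain ⟨g, ⟨-, hg⟩, -⟩ := Complex.isCoveringMapOn_exp.existsUnique_continuousMap_lifts
    ⟨f, hf⟩ (a₀ := x₀) (Complex.exp_log (h0 x₀)) h0
  exact ⟨g, g.continuous, fun x => congrFun hg x⟩

/-- Two continuous logarithms of proportional functions on the line differ by a constant. -/
theorem log_change_eq {g g' : ℝ → ℂ} (hg : Continuous g) (hg' : Continuous g') (c : ℂ)
    (h : ∀ t, Complex.exp (g t) = c * Complex.exp (g' t)) : g 1 - g 0 = g' 1 - g' 0 := by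
  have hc : ∀ t, Complex.exp (g t - g' t) = c := fun t => by
    rw [Complex.exp_sub, h, mul_div_cancel_right₀ _ (Complex.exp_ne_zero _)]
  have huniq := (Complex.isCoveringMapOn_exp.existsUnique_continuousMap_lifts
    (ContinuousMap.const ℝ c) (a₀ := (0 : ℝ)) (hc 0)
    (fun _ => by simp [← hc 0])).unique
    (y₁ := ⟨fun t => g t - g' t, hg.sub hg'⟩) (y₂ := ContinuousMap.const ℝ (g 0 - g' 0))
    ⟨rfl, funext hc⟩ ⟨rfl, funext fun _ => hc 0⟩
  have := congrArg (fun F : C(ℝ, ℂ) => F 1) huniq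
  simp only [ContinuousMap.coe_mk, ContinuousMap.const_apply] at this
  linear_combination this

/-- For two curves `α`, `β` that do not meet, the direction from a point of `α` to a point of `β`
is defined on a square, so the changes of its logarithm along the two ways around the square
agree. -/
theorem log_change_square {α β : ℝ → ℂ} (hα : Continuous α) (hβ : Continuous β)
    (h : ∀ s t, α s ≠ β t) {g₀ g₁ k₀ k₁ : ℝ → ℂ}
    (cg₀ : Continuous g₀) (cg₁ : Continuous g₁) (ck₀ : Continuous k₀) (ck₁ : Continuous k₁)
    (hg₀ : ∀ t, Complex.exp (g₀ t) = β t - α 0) (hg₁ : ∀ t, Complex.exp (g₁ t) = β t - α 1)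
    (hk₀ : ∀ s, Complex.exp (k₀ s) = α s - β 0) (hk₁ : ∀ s, Complex.exp (k₁ s) = α s - β 1) :
    (g₁ 1 - g₁ 0) - (g₀ 1 - g₀ 0) = (k₁ 1 - k₁ 0) - (k₀ 1 - k₀ 0) := by
  obtain ⟨G, cG, hG⟩ := exists_continuous_log (X := ℝ × ℝ) (f := fun x => β x.2 - α x.1)
    (by fun_prop) (fun x => sub_ne_zero.2 (h x.1 x.2).symm)
  have e₁ := log_change_eq (g := fun t => G (0, t)) (by fun_prop) cg₀ 1 fun t => by
    rw [hG, hg₀, one_mul]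
  have e₂ := log_change_eq (g := fun t => G (1, t)) (by fun_prop) cg₁ 1 fun t => by
    rw [hG, hg₁, one_mul]
  have e₃ := log_change_eq (g := fun s => G (s, 0)) (by fun_prop) ck₀ (-1) fun s => by
    rw [hG, hk₀]; ring
  have e₄ := log_change_eq (g := fun s => G (s, 1)) (by fun_prop) ck₁ (-1) fun s => by
    rw [hG, hk₁]; ring
  linear_combination e₁ - e₂ - e₃ + e₄

/-- The parity count behind the nonplanarity of `K₅`: summed over the fifteen pairs of disjoint
edges, every `N i k l` with `k < l` occurs twice on the left, while the right-hand side is odd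
exactly for the five crossing pairs of diagonals in a convex pentagon. -/
theorem no_integer_windings (N : Fin 5 → Fin 5 → Fin 5 → ℤ)
    (hN : ∀ i j k l : Fin 5, i < j → k < l → i ≠ k → i ≠ l → j ≠ k → j ≠ l →
      N j k l - N i k l - N l i j + N k i j =
        (if j < l then 1 else 0) - (if j < k then 1 else 0) - (if i < l then 1 else 0)
          + (if i < k then 1 else 0)) : False := by
  have h01_23 := hN 0 1 2 3 (by decide) (by decide) (by decide) (by decide) (by decide) (by decide)
  have h01_24 := hN 0 1 2 4 (by decide) (by decide) (by decide) (by decide) (by decide) (by decide)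
  have h01_34 := hN 0 1 3 4 (by decide) (by decide) (by decide) (by decide) (by decide) (by decide)
  have h02_13 := hN 0 2 1 3 (by decide) (by decide) (by decide) (by decide) (by decide) (by decide)
  have h02_14 := hN 0 2 1 4 (by decide) (by decide) (by decide) (by decide) (by decide) (by decide)
  have h02_34 := hN 0 2 3 4 (by decide) (by decide) (by decide) (by decide) (by decide) (by decide)
  have h03_12 := hN 0 3 1 2 (by decide) (by decide) (by decide) (by decide) (by decide) (by decide)
  have h03_14 := hN 0 3 1 4 (by decide) (by decide) (by decide) (by decide) (by decide) (by decide)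
  have h03_24 := hN 0 3 2 4 (by decide) (by decide) (by decide) (by decide) (by decide) (by decide)
  have h04_12 := hN 0 4 1 2 (by decide) (by decide) (by decide) (by decide) (by decide) (by decide)
  have h04_13 := hN 0 4 1 3 (by decide) (by decide) (by decide) (by decide) (by decide) (by decide)
  have h04_23 := hN 0 4 2 3 (by decide) (by decide) (by decide) (by decide) (by decide) (by decide)
  have h12_34 := hN 1 2 3 4 (by decide) (by decide) (by decide) (by decide) (by decide) (by decide)
  have h13_24 := hN 1 3 2 4 (by decide) (by decide) (by decide) (by decide) (by decide) (by decide)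
  have h14_23 := hN 1 4 2 3 (by decide) (by decide) (by decide) (by decide) (by decide) (by decide)
  simp (decide := true) only [if_true, if_false] at *
  omega

/-- However five points of the plane are joined pairwise by curves, some two curves without a
common end meet. The curves need not be simple. -/
theorem exists_disjoint_edges_meet (p : Fin 5 → ℂ) (γ : Fin 5 → Fin 5 → ℝ → ℂ)
    (hc : ∀ i j, Continuous (γ i j)) (h0 : ∀ i j, i < j → γ i j 0 = p i)
    (h1 : ∀ i j, i < j → γ i j 1 = p j) :
    ∃ i j k l, i < j ∧ k < l ∧ i ≠ k ∧ i ≠ l ∧ j ≠ k ∧ j ≠ l ∧ ∃ s t, γ i j s = γ k l t := by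
  by_contra! H
  have hfifth : ∀ i k l : Fin 5, ∃ j, j ≠ i ∧ j ≠ k ∧ j ≠ l := by decide
  have hne : ∀ i k l, k < l → i ≠ k → i ≠ l → ∀ t, γ k l t ≠ p i := by
    intro i k l hkl hik hil t
    obtain ⟨j, hji, hjk, hjl⟩ := hfifth i k l
    rcases lt_or_gt_of_ne hji with h | h
    · rw [← h1 j i h]; exact H k l j i hkl h hjk.symm hik.symm hjl.symm hil.symm t 1
    · rw [← h0 i j h]; exact H k l i j hkl h hik.symm hjk.symm hil.symm hjl.symm t 0
  have hp : ∀ i j, i ≠ j → p i ≠ p j := by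
    intro i j hij
    obtain ⟨k, hki, hkj, -⟩ := hfifth i j j
    rcases lt_or_gt_of_ne hki with h | h
    · rw [← h1 k i h]; exact hne j k i h hkj.symm hij.symm 1
    · rw [← h0 i k h]; exact hne j i k h hij.symm hkj.symm 0
  have hlog : ∀ i k l, ∃ g : ℝ → ℂ, Continuous g ∧
      (k < l → i ≠ k → i ≠ l → ∀ t, Complex.exp (g t) = γ k l t - p i) := by
    intro i k l
    by_cases h : k < l ∧ i ≠ k ∧ i ≠ l
    · obtain ⟨g, cg, hg⟩ := exists_continuous_log (f := fun t => γ k l t - p i)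
        ((hc k l).sub continuous_const)
        (fun t => sub_ne_zero.2 (hne i k l h.1 h.2.1 h.2.2 t))
      exact ⟨g, cg, fun _ _ _ => hg⟩
    · exact ⟨0, continuous_const, fun a b c => absurd ⟨a, b, c⟩ h⟩
  choose g cg hg using hlog
  -- Logarithms `θ i j` of the directions `p j - p i`, with `θ j i = θ i j + π I` for `i < j`.
  set θ : Fin 5 → Fin 5 → ℂ := fun i j =>
    if i < j then Complex.log (p j - p i) else Complex.log (p i - p j) + Real.pi * Complex.I with hθ
  have hθexp : ∀ i j, i ≠ j → Complex.exp (θ i j) = p j - p i := by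
    intro i j hij
    simp only [hθ]
    split_ifs with h
    · exact Complex.exp_log (sub_ne_zero.2 (hp j i hij.symm))
    · rw [Complex.exp_add, Complex.exp_log (sub_ne_zero.2 (hp i j hij)), Complex.exp_pi_mul_I]
      ring
  have hθsymm : ∀ i j, i ≠ j → θ j i - θ i j =
      (2 * (if i < j then 1 else 0 : ℤ) - 1 : ℤ) * (Real.pi * Complex.I) := by
    intro i j hij
    simp only [hθ]
    rcases lt_or_gt_of_ne hij with h | h <;> simp [h, h.not_gt]
  have hwind : ∀ i k l, ∃ n : ℤ, k < l → i ≠ k → i ≠ l →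
      g i k l 1 - g i k l 0 = θ i l - θ i k + n * (2 * Real.pi * Complex.I) := by
    intro i k l
    by_cases h : k < l ∧ i ≠ k ∧ i ≠ l
    · obtain ⟨a, b, c⟩ := h
      obtain ⟨n, hn⟩ := Complex.exp_eq_exp_iff_exists_int.1
        (show Complex.exp (g i k l 1 - g i k l 0) = Complex.exp (θ i l - θ i k) by
          rw [Complex.exp_sub, Complex.exp_sub, hg i k l a b c, hg i k l a b c, h0 k l a, h1 k l a,
            hθexp i l c, hθexp i k b])
      exact ⟨n, fun _ _ _ => hn⟩
    · exact ⟨0, fun a b c => absurd ⟨a, b, c⟩ h⟩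
  choose N hN using hwind
  refine no_integer_windings N fun i j k l hij hkl hik hil hjk hjl => ?_
  have hsq := log_change_square (hc i j) (hc k l) (H i j k l hij hkl hik hil hjk hjl)
    (cg i k l) (cg j k l) (cg k i j) (cg l i j)
    (fun t => by rw [hg i k l hkl hik hil, h0 i j hij])
    (fun t => by rw [hg j k l hkl hjk hjl, h1 i j hij])
    (fun t => by rw [hg k i j hij hik.symm hjk.symm, h0 k l hkl])
    (fun t => by rw [hg l i j hij hil.symm hjl.symm, h1 k l hkl])
  rw [hN i k l hkl hik hil, hN j k l hkl hjk hjl, hN k i j hij hik.symm hjk.symm,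
    hN l i j hij hil.symm hjl.symm] at hsq
  have e₁ := hθsymm j l hjl
  have e₂ := hθsymm j k hjk
  have e₃ := hθsymm i l hil
  have e₄ := hθsymm i k hik
  have hI : (2 * Real.pi * Complex.I) ≠ 0 := Complex.two_pi_I_ne_zero
  have key : ((N j k l - N i k l - N l i j + N k i j : ℤ) : ℂ) =
      (((if j < l then 1 else 0) - (if j < k then 1 else 0) - (if i < l then 1 else 0)
          + (if i < k then 1 else 0) : ℤ) : ℂ) := by
    apply mul_right_cancel₀ hI
    push_cast at e₁ e₂ e₃ e₄ ⊢
    linear_combination hsq + e₁ - e₂ - e₃ + e₄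
  exact_mod_cast key

/-! ### Planar graphs have no `K₅` minor -/

/-- The part of a drawing that belongs to a set `U` of vertices: the points of `U` and the arcs of
the edges inside `U`. -/
def PlaneDrawing.trace {V : Type*} {G : SimpleGraph V} (P : PlaneDrawing G) (U : Set V) :
    Set Plane :=
  {z | (∃ x ∈ U, z = P.point x) ∨
    ∃ e : G.edgeSet, (∀ x ∈ (e : Sym2 V), x ∈ U) ∧ ∃ t, z = P.arc e t}

/-- A point of an arc is an end of its edge or lies inside the arc. -/
theorem PlaneDrawing.arc_cases {V : Type*} {G : SimpleGraph V} (P : PlaneDrawing G)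
    (e : G.edgeSet) (t : unitInterval) :
    (∃ x ∈ (e : Sym2 V), P.arc e t = P.point x) ∨ t ∈ Set.Ioo (0 : unitInterval) 1 := by
  obtain ⟨x, y, he, hx, hy⟩ := P.arc_ends e
  rcases eq_or_ne t 0 with rfl | h0
  · exact Or.inl ⟨x, by simp [he], hx⟩
  rcases eq_or_ne t 1 with rfl | h1
  · exact Or.inl ⟨y, by simp [he], hy⟩
  · exact Or.inr ⟨unitInterval.pos_iff_ne_zero.2 h0, unitInterval.lt_one_iff_ne_one.2 h1⟩

theorem PlaneDrawing.trace_disjoint {V : Type*} {G : SimpleGraph V} (P : PlaneDrawing G)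
    {U U' : Set V} (h : Disjoint U U') : Disjoint (P.trace U) (P.trace U') := by
  rw [Set.disjoint_left] at h ⊢
  have key : ∀ (U : Set V), ∀ z ∈ P.trace U, (∃ x ∈ U, z = P.point x) ∨
      ∃ e : G.edgeSet, (∀ x ∈ (e : Sym2 V), x ∈ U) ∧ ∃ t ∈ Set.Ioo (0 : unitInterval) 1,
        z = P.arc e t := by
    rintro U z (h | ⟨e, he, t, rfl⟩)
    · exact Or.inl h
    · rcases P.arc_cases e t with ⟨x, hx, hxt⟩ | ht
      · exact Or.inl ⟨x, he x hx, hxt⟩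
      · exact Or.inr ⟨e, he, t, ht, rfl⟩
  intro z hz hz'
  rcases key U z hz with ⟨x, hx, rfl⟩ | ⟨e, he, t, ht, rfl⟩
  · rcases key U' _ hz' with ⟨x', hx', hxx⟩ | ⟨e', he', t', ht', hxx⟩
    · exact h hx (P.point_injective hxx ▸ hx')
    · exact P.arc_ne_point e' t' ht' x hxx.symm
  · rcases key U' _ hz' with ⟨x', hx', hxx⟩ | ⟨e', he', t', ht', hxx⟩
    · exact P.arc_ne_point e t ht x' hxx
    · refine P.arc_disjoint e e' ?_ t ht t' ht' hxx
      rintro rfl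
      obtain ⟨x, y, hxy, -, -⟩ := P.arc_ends e
      have : x ∈ (e : Sym2 V) := by simp [hxy]
      exact h (he x this) (he' x this)

theorem PlaneDrawing.joinedIn_trace_of_adj {V : Type*} {G : SimpleGraph V} (P : PlaneDrawing G)
    {U : Set V} {x y : V} (hx : x ∈ U) (hy : y ∈ U) (h : G.Adj x y) :
    JoinedIn (P.trace U) (P.point x) (P.point y) := by
  obtain ⟨x', y', he, hx', hy'⟩ := P.arc_ends ⟨s(x, y), h⟩
  have hj : JoinedIn (P.trace U) (P.point x') (P.point y') := by
    refine ⟨⟨⟨P.arc _, P.arc_continuous _⟩, hx', hy'⟩, fun t => Or.inr ⟨⟨s(x, y), h⟩, ?_, t, rfl⟩⟩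
    simp [hx, hy]
  rcases Sym2.eq_iff.1 he with ⟨rfl, rfl⟩ | ⟨rfl, rfl⟩
  · exact hj
  · exact hj.symm

theorem PlaneDrawing.joinedIn_trace {V : Type*} {G : SimpleGraph V} (P : PlaneDrawing G)
    {U : Set V} (hU : (G.induce U).Connected) {x y : V} (hx : x ∈ U) (hy : y ∈ U) :
    JoinedIn (P.trace U) (P.point x) (P.point y) := by
  obtain ⟨w⟩ := hU.preconnected ⟨x, hx⟩ ⟨y, hy⟩
  suffices ∀ a b : U, (G.induce U).Walk a b →
      JoinedIn (P.trace U) (P.point a) (P.point b) from this _ _ w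
  intro a b w
  induction w with
  | nil => exact JoinedIn.refl (Or.inl ⟨_, Subtype.prop _, rfl⟩)
  | cons h _ ih => exact (P.joinedIn_trace_of_adj (Subtype.prop _) (Subtype.prop _) h).trans ih

/-- Two adjacent branch sets of a `K₅` minor are joined by a curve in the trace of their union;
these curves violate `exists_disjoint_edges_meet`. -/
theorem PlaneDrawing.not_isMinor_top {V : Type*} {G : SimpleGraph V} (P : PlaneDrawing G) :
    ¬ IsMinor (⊤ : SimpleGraph (Fin 5)) G := by
  rintro ⟨B, hB, hdisj, hadj⟩
  have hne : ∀ i, ∃ x, x ∈ B i := fun i =>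
    let ⟨x⟩ := (hB i).nonempty
    ⟨x, x.2⟩
  choose r hr using hne
  let Φ : Plane ≃L[ℝ] ℂ := Complex.orthonormalBasisOneI.repr.symm.toContinuousLinearEquiv
  have hpath : ∀ i j, ∃ γ : ℝ → Plane, Continuous γ ∧ (i < j → γ 0 = P.point (r i) ∧
      γ 1 = P.point (r j) ∧ ∀ t, γ t ∈ P.trace (B i ∪ B j)) := by
    intro i j
    by_cases hij : i < j
    · obtain ⟨x, hx, y, hy, hxy⟩ := hadj i j hij.ne
      obtain ⟨γ, hγ⟩ := P.joinedIn_trace (SimpleGraph.connected_induce_union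
        (hB i).preconnected (hB j).preconnected hx hy hxy) (Or.inl (hr i)) (Or.inr (hr j))
      exact ⟨γ.extend, γ.continuous_extend, fun _ =>
        ⟨γ.extend_zero, γ.extend_one, fun t => hγ _⟩⟩
    · exact ⟨fun _ => 0, continuous_const, fun h => absurd h hij⟩
  choose γ hγc hγ using hpath
  obtain ⟨i, j, k, l, hij, hkl, hik, hil, hjk, hjl, s, t, hst⟩ :=
    exists_disjoint_edges_meet (fun i => Φ (P.point (r i))) (fun i j t => Φ (γ i j t))
      (fun i j => Φ.continuous.comp (hγc i j)) (fun i j h => congrArg Φ (hγ i j h).1)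
      (fun i j h => congrArg Φ (hγ i j h).2.1)
  have hd : Disjoint (B i ∪ B j) (B k ∪ B l) := by
    simp only [Set.disjoint_union_left, Set.disjoint_union_right]
    exact ⟨⟨hdisj _ _ hik, hdisj _ _ hjk⟩, hdisj _ _ hil, hdisj _ _ hjl⟩
  refine Set.disjoint_left.1 (P.trace_disjoint hd) ((hγ i j hij).2.2 s) ?_
  rw [Φ.injective hst]
  exact (hγ k l hkl).2.2 t

/-- A drawing of a graph restricts to a drawing of its subgraphs. -/
theorem PlaneDrawing.nonempty_of_hom {V W : Type*} {G : SimpleGraph V} {H : SimpleGraph W}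
    (P : PlaneDrawing H) (f : G →g H) (hf : Function.Injective f) :
    Nonempty (PlaneDrawing G) := by
  have hinj : Function.Injective f.mapEdgeSet := SimpleGraph.Hom.mapEdgeSet.injective f hf
  refine ⟨⟨fun x => P.point (f x), fun e => P.arc (f.mapEdgeSet e), P.point_injective.comp hf,
    fun e => P.arc_continuous _, fun e => P.arc_injective _, fun e => ?_,
    fun e t ht x => P.arc_ne_point _ t ht _,
    fun e e' hee t ht t' ht' => P.arc_disjoint _ _ (hinj.ne hee) t ht t' ht'⟩⟩
  obtain ⟨x, y, hxy, hx, hy⟩ := P.arc_ends (f.mapEdgeSet e)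
  obtain ⟨e, he⟩ := e
  induction e using Sym2.ind with
  | _ a b =>
    change s(f a, f b) = s(x, y) at hxy
    rcases Sym2.eq_iff.1 hxy with ⟨rfl, rfl⟩ | ⟨rfl, rfl⟩
    · exact ⟨a, b, rfl, hx, hy⟩
    · exact ⟨b, a, Sym2.eq_swap, hx, hy⟩

theorem planarGraphs_of_hom {V : Type u} {W : Type v} {G : SimpleGraph V} {H : SimpleGraph W}
    (hH : planarGraphs H) (f : G →g H) (hf : Function.Injective f) : planarGraphs G :=
  have := hH.1
  ⟨Finite.of_injective f hf, hH.2.some.nonempty_of_hom f hf⟩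

/-! ### The graphs `D n` with cyclic indices -/

/-- The vertex `a x` of `D n`, with a cyclic index `x`. -/
def cycA {n : ℕ} [NeZero n] (x : ZMod n) : DVertex n := .a ⟨x.val, ZMod.val_lt x⟩

/-- The vertex `b x` of `D n`, with a cyclic index `x`. -/
def cycB {n : ℕ} [NeZero n] (x : ZMod n) : DVertex n := .b ⟨x.val, ZMod.val_lt x⟩

theorem ne_add_one {n : ℕ} (hn : 2 ≤ n) (x : ZMod n) : x ≠ x + 1 := by
  have : Fact (1 < n) := ⟨hn⟩
  simp

theorem not_D_adj_v₁_v₂ {n : ℕ} : ¬ (D n).Adj .v₁ .v₂ := by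
  rw [D, SimpleGraph.fromRel_adj]
  rintro ⟨-, h | h⟩ <;> cases h

section Cyclic

variable {n : ℕ} [NeZero n]

theorem cycA_inj {x y : ZMod n} : cycA x = cycA y ↔ x = y := by
  simp only [cycA, DVertex.a.injEq, Fin.mk.injEq]
  exact (ZMod.val_injective n).eq_iff

theorem cycB_inj {x y : ZMod n} : cycB x = cycB y ↔ x = y := by
  simp only [cycB, DVertex.b.injEq, Fin.mk.injEq]
  exact (ZMod.val_injective n).eq_iff

theorem DVertex.cyc_cases (v : DVertex n) :
    v = .v₁ ∨ v = .v₂ ∨ (∃ x : ZMod n, v = cycA x) ∨ ∃ x : ZMod n, v = cycB x := by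
  have h : ∀ i : Fin n, ((i : ℕ) : ZMod n).val = i := fun i => ZMod.val_cast_of_lt i.2
  cases v with
  | v₁ => simp
  | v₂ => simp
  | a i => exact Or.inr (Or.inr (Or.inl ⟨(i : ℕ), by simp [cycA, h]⟩))
  | b i => exact Or.inr (Or.inr (Or.inr ⟨(i : ℕ), by simp [cycB, h]⟩))

theorem zmod_eq_add_one_iff_val {x y : ZMod n} :
    y = x + 1 ↔ y.val = x.val + 1 ∨ y.val = 0 ∧ x.val + 1 = n := by
  have hx : ((x.val + 1 : ℕ) : ZMod n) = x + 1 := by simp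
  constructor
  · rintro rfl
    rcases (Nat.succ_le_of_lt (ZMod.val_lt x)).lt_or_eq with h | h
    · left
      rw [← hx, ZMod.val_cast_of_lt h]
    · right
      refine ⟨?_, h⟩
      rw [← hx, ← Nat.succ_eq_add_one, h]
      simp
  · rintro (h | ⟨h, h'⟩)
    · rw [← hx, ← h]; simp
    · rw [← hx, h']; simpa using h

theorem D_adj_v₁_cycA (x : ZMod n) : (D n).Adj .v₁ (cycA x) :=
  (SimpleGraph.fromRel_adj _ _ _).2 ⟨by simp [cycA], Or.inl (.va _)⟩

theorem D_adj_v₂_cycB (x : ZMod n) : (D n).Adj .v₂ (cycB x) :=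
  (SimpleGraph.fromRel_adj _ _ _).2 ⟨by simp [cycB], Or.inl (.vb _)⟩

theorem not_D_adj_v₁_cycB (x : ZMod n) : ¬ (D n).Adj .v₁ (cycB x) := by
  rw [D, SimpleGraph.fromRel_adj]
  rintro ⟨-, h | h⟩ <;> cases h

theorem not_D_adj_v₂_cycA (x : ZMod n) : ¬ (D n).Adj .v₂ (cycA x) := by
  rw [D, SimpleGraph.fromRel_adj]
  rintro ⟨-, h | h⟩ <;> cases h

theorem D_adj_cycA_cycA (hn : 2 ≤ n) {x y : ZMod n} :
    (D n).Adj (cycA x) (cycA y) ↔ y = x + 1 ∨ x = y + 1 := by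
  rw [D, SimpleGraph.fromRel_adj]
  constructor
  · simp only [zmod_eq_add_one_iff_val]
    rintro ⟨-, h | h⟩ <;> cases h <;> simp_all
  · intro h
    refine ⟨?_, ?_⟩
    · rw [ne_eq, cycA_inj]
      rintro rfl
      exact ne_add_one hn x (or_self_iff.1 h)
    · simp only [zmod_eq_add_one_iff_val] at h
      rcases h with (h | ⟨h, h'⟩) | (h | ⟨h, h'⟩)
      · exact Or.inl (.aa _ _ h)
      · exact Or.inr (.aa_close _ _ h h')
      · exact Or.inr (.aa _ _ h)
      · exact Or.inl (.aa_close _ _ h h')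

theorem D_adj_cycB_cycB (hn : 2 ≤ n) {x y : ZMod n} :
    (D n).Adj (cycB x) (cycB y) ↔ y = x + 1 ∨ x = y + 1 := by
  rw [D, SimpleGraph.fromRel_adj]
  constructor
  · simp only [zmod_eq_add_one_iff_val]
    rintro ⟨-, h | h⟩ <;> cases h <;> simp_all
  · intro h
    refine ⟨?_, ?_⟩
    · rw [ne_eq, cycB_inj]
      rintro rfl
      exact ne_add_one hn x (or_self_iff.1 h)
    · simp only [zmod_eq_add_one_iff_val] at h
      rcases h with (h | ⟨h, h'⟩) | (h | ⟨h, h'⟩)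
      · exact Or.inl (.bb _ _ h)
      · exact Or.inr (.bb_close _ _ h h')
      · exact Or.inr (.bb _ _ h)
      · exact Or.inl (.bb_close _ _ h h')

theorem D_adj_cycA_cycB {x y : ZMod n} :
    (D n).Adj (cycA x) (cycB y) ↔ x = y ∨ x = y + 1 := by
  rw [D, SimpleGraph.fromRel_adj]
  constructor
  · simp only [zmod_eq_add_one_iff_val]
    rintro ⟨-, h | h⟩
    · generalize hv : cycA x = v at h
      generalize hw : cycB y = w at h
      cases h with
      | va | vb | aa | bb | ba | aa_close | bb_close => simp [cycA, cycB] at hv hw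
      | ab i =>
        simp only [cycA, cycB, DVertex.a.injEq, DVertex.b.injEq, Fin.ext_iff] at hv hw
        exact Or.inl (ZMod.val_injective n (hv.trans hw.symm))
      | ab_close i j hi hj =>
        simp only [cycA, cycB, DVertex.a.injEq, DVertex.b.injEq, Fin.ext_iff] at hv hw
        exact Or.inr (Or.inr ⟨hv.trans hi, by rw [hw, hj]⟩)
    · cases h; simp_all
  · intro h
    refine ⟨by simp [cycA, cycB], ?_⟩
    rw [zmod_eq_add_one_iff_val] at h
    rcases h with rfl | h | ⟨h, h'⟩
    · exact Or.inl (.ab _)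
    · exact Or.inr (.ba _ _ h)
    · exact Or.inl (.ab_close _ _ h h')

end Cyclic

/-! ### Drawings of the graphs `D n` -/

/-- A drawing given by curves in the complex plane that are indexed by a type `ι` from which the
edges are obtained by a map that need not be injective. -/
theorem nonempty_planeDrawing {V : Type*} {G : SimpleGraph V} {ι : Type*} (pt : V → ℂ)
    (ends : ι → V × V) (curve : ι → ℝ → ℂ)
    (hcover : ∀ x y, G.Adj x y → ∃ i, s(x, y) = s((ends i).1, (ends i).2))
    (hpt : Function.Injective pt)
    (hcont : ∀ i, ContinuousOn (curve i) (Set.Icc 0 1))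
    (hinj : ∀ i, Set.InjOn (curve i) (Set.Icc 0 1))
    (h0 : ∀ i, curve i 0 = pt (ends i).1) (h1 : ∀ i, curve i 1 = pt (ends i).2)
    (hne : ∀ i, ∀ t ∈ Set.Ioo (0 : ℝ) 1, ∀ x, curve i t ≠ pt x)
    (hdisj : ∀ i j, ∀ t ∈ Set.Ioo (0 : ℝ) 1, ∀ t' ∈ Set.Ioo (0 : ℝ) 1,
      curve i t = curve j t' → i = j) :
    Nonempty (PlaneDrawing G) := by
  let Φ : ℂ ≃L[ℝ] Plane := Complex.orthonormalBasisOneI.repr.toContinuousLinearEquiv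
  have hidx : ∀ e : G.edgeSet, ∃ i, (e : Sym2 V) = s((ends i).1, (ends i).2) := by
    rintro ⟨e, he⟩
    induction e using Sym2.ind with
    | _ x y => exact hcover x y he
  choose idx hidx using hidx
  refine ⟨⟨fun x => Φ (pt x), fun e t => Φ (curve (idx e) t), Φ.injective.comp hpt,
    fun e => ?_, fun e t t' h => ?_, fun e => ⟨_, _, hidx e, ?_, ?_⟩, fun e t ht x h => ?_,
    fun e e' hee t ht t' ht' h => ?_⟩⟩
  · exact Φ.continuous.comp (continuousOn_iff_continuous_domRestrict.1 (hcont _))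
  · exact Subtype.ext (hinj _ t.2 t'.2 (Φ.injective h))
  · exact congrArg Φ (h0 _)
  · exact congrArg Φ (h1 _)
  · exact hne _ t ht x (Φ.injective h)
  · refine hee (Subtype.ext ?_)
    rw [hidx e, hidx e', hdisj _ _ t ht t' ht' (Φ.injective h)]

/-- The point of the unit circle at the angle `θ / n` of a full turn. -/
noncomputable def turn (n : ℕ) (θ : ℝ) : ℂ := Complex.exp ((2 * Real.pi * (θ / n) : ℝ) * Complex.I)

/-- The cylinder with angle `θ` (modulo `n`) and height `r ∈ [0, 3]`, mapped to the plane. The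
height `0` is collapsed to one point and the height `3` to another, and the map is not defined at
`θ = 1 / 2`, `r = 3 / 5`. It is the map `(θ, r) ↦ r / (3 - r) * turn n θ` to the Riemann sphere,
followed by the Möbius map `z ↦ 1 / (z - z₀)`, `z₀ = turn n (1 / 2) / 4`. -/
noncomputable def cyl (n : ℕ) (θ r : ℝ) : ℂ :=
  ((3 - r : ℝ) : ℂ) / ((r : ℂ) * turn n θ - ((3 - r : ℝ) : ℂ) * (turn n (1 / 2) / 4))

theorem norm_turn (n : ℕ) (θ : ℝ) : ‖turn n θ‖ = 1 := Complex.norm_exp_ofReal_mul_I _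

theorem turn_eq_iff {n : ℕ} (hn : n ≠ 0) {θ θ' : ℝ} :
    turn n θ = turn n θ' ↔ ∃ m : ℤ, θ - θ' = m * n := by
  have hn' : (n : ℂ) ≠ 0 := Nat.cast_ne_zero.2 hn
  have hpi : (2 * Real.pi * Complex.I) ≠ 0 := Complex.two_pi_I_ne_zero
  rw [turn, turn, Complex.exp_eq_exp_iff_exists_int]
  refine exists_congr fun m => ?_
  have : (θ - θ' = m * n) ↔ ((θ : ℂ) - θ' = m * n) := by exact_mod_cast Iff.rfl
  rw [this]
  push_cast
  constructor
  · intro h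
    apply mul_left_cancel₀ hpi
    field_simp at h ⊢
    linear_combination h
  · intro h
    field_simp
    linear_combination h

theorem cyl_denom_ne_zero {n : ℕ} (hn : n ≠ 0) {θ r : ℝ} (hr0 : 0 ≤ r) (hr3 : r ≤ 3)
    (h : r = 3 / 5 → ¬ ∃ m : ℤ, θ - 1 / 2 = m * n) :
    (r : ℂ) * turn n θ - ((3 - r : ℝ) : ℂ) * (turn n (1 / 2) / 4) ≠ 0 := by
  intro h0
  rw [sub_eq_zero] at h0
  have hnorm := congrArg norm h0
  rw [norm_mul, norm_mul, norm_div, norm_turn, norm_turn, Complex.norm_real, Complex.norm_real,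
    Real.norm_of_nonneg hr0, Real.norm_of_nonneg (by linarith)] at hnorm
  norm_num at hnorm
  have hr : r = 3 / 5 := by linarith
  refine h hr ((turn_eq_iff hn).1 ?_)
  subst hr
  push_cast at h0
  linear_combination (5 / 3) * h0

/-- Off the hole, the map `cyl` identifies only angles that are equal modulo `n` and the points of
the two collapsed circles. -/
theorem cyl_eq {n : ℕ} (hn : n ≠ 0) {θ r θ' r' : ℝ} (hr0 : 0 ≤ r) (hr3 : r ≤ 3)
    (hr0' : 0 ≤ r') (hr3' : r' ≤ 3) (h : r = 3 / 5 → ¬ ∃ m : ℤ, θ - 1 / 2 = m * n)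
    (h' : r' = 3 / 5 → ¬ ∃ m : ℤ, θ' - 1 / 2 = m * n) (heq : cyl n θ r = cyl n θ' r') :
    r = r' ∧ (0 < r → r < 3 → ∃ m : ℤ, θ - θ' = m * n) := by
  have hd := cyl_denom_ne_zero hn hr0 hr3 h
  have hd' := cyl_denom_ne_zero hn hr0' hr3' h'
  rw [cyl, cyl, div_eq_div_iff hd hd'] at heq
  have hcross : (((3 - r) * r' : ℝ) : ℂ) * turn n θ' = (((3 - r') * r : ℝ) : ℂ) * turn n θ := by
    push_cast at heq ⊢
    linear_combination heq
  have hnorm := congrArg norm hcross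
  rw [norm_mul, norm_mul, norm_turn, norm_turn, Complex.norm_real, Complex.norm_real,
    Real.norm_of_nonneg (mul_nonneg (by linarith) hr0'),
    Real.norm_of_nonneg (mul_nonneg (by linarith) hr0)] at hnorm
  have hrr : r = r' := by linarith
  refine ⟨hrr, fun hpos hlt => (turn_eq_iff hn).1 ?_⟩
  subst hrr
  have : (((3 - r) * r : ℝ) : ℂ) ≠ 0 :=
    Complex.ofReal_ne_zero.2 (mul_ne_zero (by linarith) hpos.ne')
  exact (mul_left_cancel₀ this hcross).symm

theorem cyl_congr {n : ℕ} (hn : n ≠ 0) {θ θ' : ℝ} (r : ℝ) (h : ∃ m : ℤ, θ - θ' = m * n) :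
    cyl n θ r = cyl n θ' r := by
  rw [cyl, cyl, (turn_eq_iff hn).2 h]

theorem cyl_zero (n : ℕ) (θ θ' : ℝ) : cyl n θ 0 = cyl n θ' 0 := by simp [cyl]

theorem cyl_three (n : ℕ) (θ θ' : ℝ) : cyl n θ 3 = cyl n θ' 3 := by simp [cyl]

/-- Angles along the curves that represent, for `x = 0`, the edges `v₁ a₀`, `a₀ a₁`, `a₀ b₀`,
`b₀ a₁`, `b₀ b₁` and `b₀ v₂`. -/
noncomputable def angleOff : Fin 6 → ℝ → ℝ :=
  ![fun _ => 0, fun t => t, fun t => t / 2, fun t => 1 / 2 + t / 2, fun t => 1 / 2 + t,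
    fun _ => 1 / 2]

/-- Heights along the same curves: `v₁`, `a`, `b` and `v₂` lie at the heights `0`, `1`, `2` and
`3`. -/
noncomputable def heightOff : Fin 6 → ℝ → ℝ :=
  ![fun t => t, fun _ => 1, fun t => 1 + t, fun t => 2 - t, fun _ => 2, fun t => 2 + t]

/-- The ends of the edges of the six kinds. -/
def edgeEnds {n : ℕ} [NeZero n] (i : Fin 6 × ZMod n) : DVertex n × DVertex n :=
  (![(.v₁, cycA i.2), (cycA i.2, cycA (i.2 + 1)), (cycA i.2, cycB i.2), (cycB i.2, cycA (i.2 + 1)),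
    (cycB i.2, cycB (i.2 + 1)), (cycB i.2, .v₂)] : Fin 6 → DVertex n × DVertex n) i.1

/-- The angle of a vertex. -/
noncomputable def vertexAngle {n : ℕ} : DVertex n → ℝ
  | .v₁ => 0
  | .v₂ => 0
  | .a i => (i : ℕ)
  | .b i => (i : ℕ) + 1 / 2

/-- The height of a vertex. -/
def vertexHeight {n : ℕ} : DVertex n → ℝ
  | .v₁ => 0
  | .v₂ => 3
  | .a _ => 1
  | .b _ => 2

theorem int_eq_zero_of_abs_lt_one {J : ℤ} {s : ℝ} (h : s = J) (h1 : -1 < s) (h2 : s < 1) :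
    J = 0 := by
  have h3 : (-1 : ℝ) < J := h ▸ h1
  have h4 : (J : ℝ) < 1 := h ▸ h2
  have h5 : -1 < J := by exact_mod_cast h3
  have h6 : J < 1 := by exact_mod_cast h4
  omega

theorem heightOff_pos (k : Fin 6) {t : ℝ} (ht : t ∈ Set.Ioo (0 : ℝ) 1) : 0 < heightOff k t := by
  obtain ⟨h0, h1⟩ := ht
  fin_cases k <;> simp [heightOff] <;> linarith

theorem heightOff_lt_three (k : Fin 6) {t : ℝ} (ht : t ∈ Set.Ioo (0 : ℝ) 1) :
    heightOff k t < 3 := by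
  obtain ⟨h0, h1⟩ := ht
  fin_cases k <;> simp [heightOff] <;> linarith

theorem heightOff_nonneg (k : Fin 6) {t : ℝ} (ht : t ∈ Set.Icc (0 : ℝ) 1) :
    0 ≤ heightOff k t := by
  obtain ⟨h0, h1⟩ := ht
  fin_cases k <;> simp [heightOff] <;> linarith

theorem heightOff_le_three (k : Fin 6) {t : ℝ} (ht : t ∈ Set.Icc (0 : ℝ) 1) :
    heightOff k t ≤ 3 := by
  obtain ⟨h0, h1⟩ := ht
  fin_cases k <;> simp [heightOff] <;> linarith

/-- The curves avoid the hole of `cyl`, which lies between the spokes at `v₁`. -/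
theorem off_avoids_hole (k : Fin 6) {t : ℝ} (ht : t ∈ Set.Icc (0 : ℝ) 1)
    (hr : heightOff k t = 3 / 5) (J : ℤ) : angleOff k t - 1 / 2 ≠ J := by
  obtain ⟨h0, h1⟩ := ht
  intro h
  have hk : k = 0 := by
    fin_cases k <;> simp [heightOff] at hr ⊢ <;> linarith
  subst hk
  simp [angleOff] at h
  have := int_eq_zero_of_abs_lt_one h (by norm_num) (by norm_num)
  subst this
  norm_num at h

/-- If interior points of two of the curves have the same height, and angles that differ by an
integer `J`, then the curves are of the same kind and `J = 0`. -/
theorem off_disjoint (k k' : Fin 6) {t t' : ℝ} (ht : t ∈ Set.Ioo (0 : ℝ) 1)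
    (ht' : t' ∈ Set.Ioo (0 : ℝ) 1) (hr : heightOff k t = heightOff k' t') (J : ℤ)
    (hJ : angleOff k t - angleOff k' t' = J) : k = k' ∧ J = 0 := by
  obtain ⟨h0, h1⟩ := ht
  obtain ⟨h0', h1'⟩ := ht'
  have hJ0 : -1 < angleOff k t - angleOff k' t' ∧ angleOff k t - angleOff k' t' < 1 → J = 0 :=
    fun h => int_eq_zero_of_abs_lt_one hJ h.1 h.2
  fin_cases k <;> fin_cases k' <;> simp [heightOff, angleOff] at hr hJ hJ0 ⊢ <;>
    first
    | exact hJ0 (by linarith) (by linarith)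
    | linarith
    | (have := hJ0 (by linarith) (by linarith); subst this; norm_num at hJ; linarith)

/-- An interior point of a curve has no vertex angle at the heights of the vertices: integers
at the height `1`, half-integers at the height `2`. -/
theorem off_ne_vertex (k : Fin 6) {t : ℝ} (ht : t ∈ Set.Ioo (0 : ℝ) 1) (J : ℤ) :
    (heightOff k t = 1 → angleOff k t ≠ J) ∧ (heightOff k t = 2 → angleOff k t - 1 / 2 ≠ J) := by
  obtain ⟨h0, h1⟩ := ht
  have hJ : t ≠ J := by
    intro h
    have := int_eq_zero_of_abs_lt_one h (by linarith) h1
    subst this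
    norm_num at h
    linarith
  fin_cases k <;> simp [heightOff, angleOff] <;>
    first
    | exact hJ
    | (constructor <;> intro h <;> linarith)

theorem off_injective (k : Fin 6) {t t' : ℝ} (ht : t ∈ Set.Icc (0 : ℝ) 1)
    (ht' : t' ∈ Set.Icc (0 : ℝ) 1) (hr : heightOff k t = heightOff k t')
    (hθ : 0 < heightOff k t → heightOff k t < 3 → angleOff k t = angleOff k t') : t = t' := by
  obtain ⟨h0, h1⟩ := ht
  obtain ⟨h0', h1'⟩ := ht'
  fin_cases k <;> simp [heightOff, angleOff] at hr hθ ⊢ <;>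
    first
    | exact hr
    | exact hθ
    | exact hθ (by norm_num)

theorem angleOff_sub_le_one (k : Fin 6) {t t' : ℝ} (ht : t ∈ Set.Icc (0 : ℝ) 1)
    (ht' : t' ∈ Set.Icc (0 : ℝ) 1) : angleOff k t - angleOff k t' ≤ 1 := by
  obtain ⟨h0, h1⟩ := ht
  obtain ⟨h0', h1'⟩ := ht'
  fin_cases k <;> simp [angleOff] <;> linarith

section Drawing

variable {n : ℕ}

theorem zmod_eq_of_val_sub_eq [NeZero n] {x y : ZMod n} {m : ℤ} (h : (x.val : ℤ) - y.val = m * n) :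
    x = y := by
  have := congrArg (Int.cast : ℤ → ZMod n) h
  push_cast at this
  simpa [sub_eq_zero] using this

/-- The curve that represents the edge with a given index. -/
noncomputable def edgeCurve (i : Fin 6 × ZMod n) (t : ℝ) : ℂ :=
  cyl n (angleOff i.1 t + i.2.val) (heightOff i.1 t)

/-- The point that represents a vertex. -/
noncomputable def vertexPoint (v : DVertex n) : ℂ := cyl n (vertexAngle v) (vertexHeight v)

theorem edgeCurve_avoids_hole (i : Fin 6 × ZMod n) {t : ℝ} (ht : t ∈ Set.Icc (0 : ℝ) 1)
    (hr : heightOff i.1 t = 3 / 5) : ¬ ∃ m : ℤ, angleOff i.1 t + i.2.val - 1 / 2 = m * n := by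
  rintro ⟨m, hm⟩
  refine off_avoids_hole i.1 ht hr (m * n - i.2.val) ?_
  push_cast
  linear_combination hm

theorem vertexHeight_ne (v : DVertex n) : vertexHeight v ≠ 3 / 5 := by
  cases v <;> norm_num [vertexHeight]

theorem vertexHeight_mem (v : DVertex n) : 0 ≤ vertexHeight v ∧ vertexHeight v ≤ 3 := by
  cases v <;> norm_num [vertexHeight]

theorem exists_val_add_one [NeZero n] (x : ZMod n) :
    ∃ m : ℤ, (1 + x.val : ℝ) - (x + 1).val = m * n := by
  rcases zmod_eq_add_one_iff_val.1 (rfl : x + 1 = x + 1) with h | ⟨h, h'⟩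
  · exact ⟨0, by rw [h]; push_cast; ring⟩
  · refine ⟨1, ?_⟩
    rw [h]
    have : (x.val + 1 : ℝ) = n := by exact_mod_cast h'
    push_cast
    linarith

theorem vertexPoint_injective [NeZero n] : Function.Injective (vertexPoint (n := n)) := by
  intro v w h
  obtain ⟨h1, h2⟩ := cyl_eq (NeZero.ne n) (vertexHeight_mem v).1 (vertexHeight_mem v).2
    (vertexHeight_mem w).1 (vertexHeight_mem w).2 (fun h => absurd h (vertexHeight_ne v))
    (fun h => absurd h (vertexHeight_ne w)) h
  have hfin : ∀ (i j : Fin n) (m : ℤ), ((i : ℕ) : ℝ) - (j : ℕ) = m * n → i = j := by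
    intro i j m hm
    have hm' : ((i : ℕ) : ℤ) - (j : ℕ) = m * n := by exact_mod_cast hm
    have := congrArg (Int.cast : ℤ → ZMod n) hm'
    push_cast at this
    rw [ZMod.natCast_self, mul_zero, sub_eq_zero, ZMod.natCast_eq_natCast_iff'] at this
    rwa [Nat.mod_eq_of_lt i.2, Nat.mod_eq_of_lt j.2, ← Fin.ext_iff] at this
  cases v <;> cases w <;> norm_num [vertexHeight] at h1 <;>
    first
    | rfl
    | (norm_num [vertexHeight, vertexAngle] at h2
       obtain ⟨m, hm⟩ := h2
       rw [hfin _ _ m hm])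

theorem continuous_edgeCurve [NeZero n] (i : Fin 6 × ZMod n) :
    ContinuousOn (edgeCurve i) (Set.Icc 0 1) := by
  have hθ : Continuous (angleOff i.1) := by
    rcases i with ⟨k, x⟩
    fin_cases k <;> simp only [angleOff] <;> simp <;> fun_prop
  have hr : Continuous (heightOff i.1) := by
    rcases i with ⟨k, x⟩
    fin_cases k <;> simp only [heightOff] <;> simp <;> fun_prop
  unfold edgeCurve cyl turn
  refine ContinuousOn.div (by fun_prop) (by fun_prop) fun t ht => ?_
  exact cyl_denom_ne_zero (NeZero.ne n) (heightOff_nonneg i.1 ht) (heightOff_le_three i.1 ht)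
    (edgeCurve_avoids_hole i ht)

theorem edgeCurve_injOn [NeZero n] (hn : 2 ≤ n) (i : Fin 6 × ZMod n) :
    Set.InjOn (edgeCurve i) (Set.Icc 0 1) := by
  intro t ht t' ht' h
  obtain ⟨h1, h2⟩ := cyl_eq (NeZero.ne n) (heightOff_nonneg i.1 ht) (heightOff_le_three i.1 ht)
    (heightOff_nonneg i.1 ht') (heightOff_le_three i.1 ht') (edgeCurve_avoids_hole i ht)
    (edgeCurve_avoids_hole i ht') h
  refine off_injective i.1 ht ht' h1 fun hpos hlt => ?_
  obtain ⟨m, hm⟩ := h2 hpos hlt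
  have hle := angleOff_sub_le_one i.1 ht ht'
  have hle' := angleOff_sub_le_one i.1 ht' ht
  have hn' : (2 : ℝ) ≤ n := by exact_mod_cast hn
  -- The angle varies by at most one along a curve, and `n ≥ 2`.
  have hm0 : m = 0 := by
    have h3 : (m : ℝ) < 1 := by nlinarith
    have h4 : (-1 : ℝ) < m := by nlinarith
    have h5 : m < 1 := by exact_mod_cast h3
    have h6 : -1 < m := by exact_mod_cast h4
    omega
  subst hm0
  norm_num at hm
  linarith

theorem edgeCurve_zero [NeZero n] (i : Fin 6 × ZMod n) :
    edgeCurve i 0 = vertexPoint (edgeEnds i).1 := by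
  obtain ⟨k, x⟩ := i
  fin_cases k <;> simp [edgeCurve, vertexPoint, edgeEnds, angleOff, heightOff, vertexAngle,
    vertexHeight, cycA, cycB, add_comm, -ZMod.natCast_val]
  exact cyl_zero _ _ _

theorem edgeCurve_one [NeZero n] (i : Fin 6 × ZMod n) :
    edgeCurve i 1 = vertexPoint (edgeEnds i).2 := by
  obtain ⟨k, x⟩ := i
  obtain ⟨m, hm⟩ := exists_val_add_one x
  have hcongr : ∀ θ θ' r : ℝ, θ - θ' = 1 + x.val - (x + 1).val → cyl n θ r = cyl n θ' r :=
    fun θ θ' r h => cyl_congr (NeZero.ne n) r ⟨m, h.trans hm⟩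
  fin_cases k <;> simp [edgeCurve, vertexPoint, edgeEnds, angleOff, heightOff, vertexAngle,
    vertexHeight, cycA, cycB, -ZMod.natCast_val]
  · exact hcongr _ _ _ rfl
  · norm_num [add_comm, -ZMod.natCast_val]
  · norm_num [-ZMod.natCast_val]
    exact hcongr _ _ _ rfl
  · exact hcongr _ _ _ (by ring)
  · norm_num [-ZMod.natCast_val]
    exact cyl_three _ _ _

theorem edgeCurve_ne_vertexPoint [NeZero n] (i : Fin 6 × ZMod n) (t : ℝ)
    (ht : t ∈ Set.Ioo (0 : ℝ) 1) (v : DVertex n) : edgeCurve i t ≠ vertexPoint v := by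
  intro h
  have ht' := Set.Ioo_subset_Icc_self ht
  obtain ⟨h1, h2⟩ := cyl_eq (NeZero.ne n) (heightOff_nonneg i.1 ht') (heightOff_le_three i.1 ht')
    (vertexHeight_mem v).1 (vertexHeight_mem v).2 (edgeCurve_avoids_hole i ht')
    (fun h => absurd h (vertexHeight_ne v)) h
  have hpos := heightOff_pos i.1 ht
  have hlt := heightOff_lt_three i.1 ht
  obtain ⟨m, hm⟩ := h2 hpos hlt
  cases v with
  | v₁ => simp only [vertexHeight] at h1; linarith
  | v₂ => simp only [vertexHeight] at h1; linarith
  | a j =>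
    refine (off_ne_vertex i.1 ht (m * n - i.2.val + (j : ℕ))).1 h1 ?_
    simp only [vertexAngle] at hm
    push_cast
    linear_combination hm
  | b j =>
    refine (off_ne_vertex i.1 ht (m * n - i.2.val + (j : ℕ))).2 h1 ?_
    simp only [vertexAngle] at hm
    push_cast
    linear_combination hm

theorem edgeCurve_disjoint [NeZero n] (i j : Fin 6 × ZMod n) (t : ℝ)
    (ht : t ∈ Set.Ioo (0 : ℝ) 1) (t' : ℝ) (ht' : t' ∈ Set.Ioo (0 : ℝ) 1)
    (h : edgeCurve i t = edgeCurve j t') : i = j := by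
  have hc := Set.Ioo_subset_Icc_self ht
  have hc' := Set.Ioo_subset_Icc_self ht'
  obtain ⟨h1, h2⟩ := cyl_eq (NeZero.ne n) (heightOff_nonneg i.1 hc) (heightOff_le_three i.1 hc)
    (heightOff_nonneg j.1 hc') (heightOff_le_three j.1 hc') (edgeCurve_avoids_hole i hc)
    (edgeCurve_avoids_hole j hc') h
  obtain ⟨m, hm⟩ := h2 (heightOff_pos i.1 ht) (heightOff_lt_three i.1 ht)
  obtain ⟨hk, hJ⟩ := off_disjoint i.1 j.1 ht ht' h1 (m * n - i.2.val + j.2.val) (by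
    push_cast
    linear_combination hm)
  exact Prod.ext hk (zmod_eq_of_val_sub_eq (m := m) (by omega))

theorem exists_edgeEnds [NeZero n] (hn : 2 ≤ n) (v w : DVertex n) (h : (D n).Adj v w) :
    ∃ i : Fin 6 × ZMod n, s(v, w) = s((edgeEnds i).1, (edgeEnds i).2) := by
  wlog H : ∃ i : Fin 6 × ZMod n, (v, w) = edgeEnds i generalizing v w
  · by_cases H' : ∃ i : Fin 6 × ZMod n, (w, v) = edgeEnds i
    · obtain ⟨i, hi⟩ := this w v h.symm H'
      exact ⟨i, Sym2.eq_swap.trans hi⟩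
    · exfalso
      obtain rfl | rfl | ⟨x, rfl⟩ | ⟨x, rfl⟩ := v.cyc_cases <;>
        obtain rfl | rfl | ⟨y, rfl⟩ | ⟨y, rfl⟩ := w.cyc_cases
      · exact (D n).loopless.irrefl _ h
      · exact not_D_adj_v₁_v₂ h
      · exact H ⟨(0, y), rfl⟩
      · exact not_D_adj_v₁_cycB _ h
      · exact not_D_adj_v₁_v₂ h.symm
      · exact (D n).loopless.irrefl _ h
      · exact not_D_adj_v₂_cycA _ h
      · exact H' ⟨(5, y), rfl⟩
      · exact H' ⟨(0, x), rfl⟩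
      · exact not_D_adj_v₂_cycA _ h.symm
      · rcases (D_adj_cycA_cycA hn).1 h with rfl | rfl
        · exact H ⟨(1, x), rfl⟩
        · exact H' ⟨(1, y), rfl⟩
      · rcases D_adj_cycA_cycB.1 h with rfl | rfl
        · exact H ⟨(2, x), rfl⟩
        · exact H' ⟨(3, y), rfl⟩
      · exact not_D_adj_v₁_cycB _ h.symm
      · exact H ⟨(5, x), rfl⟩
      · rcases D_adj_cycA_cycB.1 h.symm with rfl | rfl
        · exact H' ⟨(2, y), rfl⟩
        · exact H ⟨(3, x), rfl⟩
      · rcases (D_adj_cycB_cycB hn).1 h with rfl | rfl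
        · exact H ⟨(4, x), rfl⟩
        · exact H' ⟨(4, y), rfl⟩
  obtain ⟨i, hi⟩ := H
  exact ⟨i, by rw [← hi]⟩

end Drawing

/-- The vertices of `D n` are two poles and two copies of `Fin n`. -/
def dVertexEquiv (n : ℕ) : DVertex n ≃ Bool ⊕ Fin n ⊕ Fin n where
  toFun
    | .v₁ => .inl true
    | .v₂ => .inl false
    | .a i => .inr (.inl i)
    | .b i => .inr (.inr i)
  invFun
    | .inl true => .v₁
    | .inl false => .v₂
    | .inr (.inl i) => .a i
    | .inr (.inr i) => .b i
  left_inv v := by cases v <;> rfl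
  right_inv v := by rcases v with (_ | _) | _ | _ <;> rfl

theorem finite_DVertex (n : ℕ) : Finite (DVertex n) := Finite.of_equiv _ (dVertexEquiv n).symm

theorem card_DVertex (n : ℕ) : Nat.card (DVertex n) = 2 + (n + n) := by
  rw [Nat.card_congr (dVertexEquiv n)]
  simp

/-- The graphs `D n` are planar: two poles, two cycles around the axis, and a zigzag between
them. -/
theorem planarGraphs_D {n : ℕ} (hn : 2 ≤ n) : planarGraphs (D n) := by
  have : NeZero n := ⟨by omega⟩
  exact ⟨finite_DVertex n, nonempty_planeDrawing vertexPoint edgeEnds edgeCurve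
    (exists_edgeEnds hn) vertexPoint_injective continuous_edgeCurve (edgeCurve_injOn hn)
    edgeCurve_zero edgeCurve_one edgeCurve_ne_vertexPoint edgeCurve_disjoint⟩

/-- `K₄` is the subgraph of `D 3` on `v₁` and the vertices `a i`. -/
theorem planarGraphs_K4 : planarGraphs (⊤ : SimpleGraph (Fin 4)) := by
  have hA : ∀ x y : ZMod 3, x ≠ y → (D 3).Adj (cycA x) (cycA y) := fun x y h =>
    (D_adj_cycA_cycA (by norm_num)).2 (by revert x y; decide)
  refine planarGraphs_of_hom (planarGraphs_D (n := 3) (by norm_num))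
    (⟨Fin.cons .v₁ fun i : Fin 3 => cycA (n := 3) i, ?_⟩ : (⊤ : SimpleGraph (Fin 4)) →g D 3) ?_
  · intro i j h
    rw [SimpleGraph.top_adj] at h
    induction i using Fin.cases with
    | zero =>
      induction j using Fin.cases with
      | zero => exact absurd rfl h
      | succ j => exact D_adj_v₁_cycA (n := 3) j
    | succ i =>
      induction j using Fin.cases with
      | zero => exact (D_adj_v₁_cycA (n := 3) i).symm
      | succ j => exact hA i j fun hij => h (congrArg Fin.succ hij)
  · refine Fin.cons_injective_iff.2 ⟨?_, fun i j h => cycA_inj.1 h⟩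
    rintro ⟨i, hi⟩
    cases hi

/-! ### Homomorphic images of the graphs `D n` -/

theorem no_K4_of_cliqueFree {V : Type*} {H : SimpleGraph V} (h : H.CliqueFree 4) {a b c d : V}
    (hab : H.Adj a b) (hac : H.Adj a c) (had : H.Adj a d) (hbc : H.Adj b c) (hbd : H.Adj b d)
    (hcd : H.Adj c d) : False := by
  classical
  refine h {a, b, c, d} ⟨?_, ?_⟩
  · rw [SimpleGraph.isClique_iff]
    intro x hx y hy hxy
    simp only [Finset.coe_insert, Finset.coe_singleton, Set.mem_insert_iff,
      Set.mem_singleton_iff] at hx hy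
    rcases hx with rfl | rfl | rfl | rfl <;> rcases hy with rfl | rfl | rfl | rfl <;>
      first
      | exact absurd rfl hxy
      | assumption
      | (apply SimpleGraph.Adj.symm; assumption)
  · simp [hab.ne, hac.ne, had.ne, hbc.ne, hbd.ne, hcd.ne]

theorem connected_induce_singleton {V : Type*} {H : SimpleGraph V} (x : V) :
    (H.induce {x}).Connected := by
  have : Nonempty ({x} : Set V) := ⟨⟨x, rfl⟩⟩
  exact ⟨SimpleGraph.Preconnected.of_subsingleton⟩

theorem connected_induce_insert {V : Type*} {H : SimpleGraph V} {s : Set V} {x y : V}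
    (hs : (H.induce s).Connected) (hy : y ∈ s) (h : H.Adj x y) :
    (H.induce (insert x s)).Connected := by
  rw [Set.insert_eq]
  exact SimpleGraph.connected_induce_union (connected_induce_singleton x).preconnected
    hs.preconnected rfl hy h

/-- A triangle and two disjoint adjacent connected sets off the triangle, both of them joined to all
three of its vertices, form a `K₅` minor. -/
theorem isMinor_top_of_triangle {V : Type*} {H : SimpleGraph V} {p q r : V} {K L : Set V}
    (hK : (H.induce K).Connected) (hL : (H.induce L).Connected) (hKL : Disjoint K L)
    (hpK : p ∉ K) (hqK : q ∉ K) (hrK : r ∉ K) (hpL : p ∉ L) (hqL : q ∉ L) (hrL : r ∉ L)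
    (hpq : H.Adj p q) (hpr : H.Adj p r) (hqr : H.Adj q r)
    (apK : ∃ y ∈ K, H.Adj p y) (aqK : ∃ y ∈ K, H.Adj q y) (arK : ∃ y ∈ K, H.Adj r y)
    (apL : ∃ y ∈ L, H.Adj p y) (aqL : ∃ y ∈ L, H.Adj q y) (arL : ∃ y ∈ L, H.Adj r y)
    (aKL : ∃ x ∈ K, ∃ y ∈ L, H.Adj x y) : IsMinor (⊤ : SimpleGraph (Fin 5)) H := by
  let B : Fin 5 → Set V := ![{p}, {q}, {r}, K, L]
  have key : ∀ i j : Fin 5, i < j → Disjoint (B i) (B j) ∧ ∃ x ∈ B i, ∃ y ∈ B j, H.Adj x y := by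
    intro i j hij
    fin_cases i <;> fin_cases j <;> first | exact absurd hij (by decide) | skip
    · exact ⟨Set.disjoint_singleton.2 hpq.ne, p, rfl, q, rfl, hpq⟩
    · exact ⟨Set.disjoint_singleton.2 hpr.ne, p, rfl, r, rfl, hpr⟩
    · exact ⟨Set.disjoint_singleton_left.2 hpK, p, rfl, apK⟩
    · exact ⟨Set.disjoint_singleton_left.2 hpL, p, rfl, apL⟩
    · exact ⟨Set.disjoint_singleton.2 hqr.ne, q, rfl, r, rfl, hqr⟩
    · exact ⟨Set.disjoint_singleton_left.2 hqK, q, rfl, aqK⟩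
    · exact ⟨Set.disjoint_singleton_left.2 hqL, q, rfl, aqL⟩
    · exact ⟨Set.disjoint_singleton_left.2 hrK, r, rfl, arK⟩
    · exact ⟨Set.disjoint_singleton_left.2 hrL, r, rfl, arL⟩
    · exact ⟨hKL, aKL⟩
  have hB : ∀ i : Fin 5, (H.induce (B i)).Connected := by
    intro i
    fin_cases i
    · exact connected_induce_singleton p
    · exact connected_induce_singleton q
    · exact connected_induce_singleton r
    · exact hK
    · exact hL
  refine ⟨B, hB, fun i j hij => ?_, fun i j hij => ?_⟩
  · rcases lt_or_gt_of_ne hij with h | h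
    · exact (key i j h).1
    · exact (key j i h).1.symm
  · rcases lt_or_gt_of_ne hij.ne with h | h
    · exact (key i j h).2
    · obtain ⟨x, hx, y, hy, hxy⟩ := (key j i h).2
      exact ⟨y, hy, x, hx, hxy.symm⟩

/-- A homomorphic image of `D n` in `H`: the images of `v₁` and `v₂` and, as sequences of period `n`
indexed by the integers, those of the vertices `a i` and `b i`. -/
structure IsStrip {V : Type*} (H : SimpleGraph V) (n : ℕ) (x₁ x₂ : V) (A B : ℤ → V) : Prop where
  pos : 0 < n
  perA : ∀ i, A (i + n) = A i
  perB : ∀ i, B (i + n) = B i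
  va : ∀ i, H.Adj x₁ (A i)
  vb : ∀ i, H.Adj x₂ (B i)
  ab : ∀ i, H.Adj (A i) (B i)
  ba : ∀ i, H.Adj (B i) (A (i + 1))
  aa : ∀ i, H.Adj (A i) (A (i + 1))
  bb : ∀ i, H.Adj (B i) (B (i + 1))

namespace IsStrip

variable {V : Type*} {H : SimpleGraph V} {n : ℕ} {x₁ x₂ : V} {A B : ℤ → V}

theorem ba' (S : IsStrip H n x₁ x₂ A B) (i : ℤ) : H.Adj (B (i - 1)) (A i) := by
  simpa using S.ba (i - 1)

theorem aa' (S : IsStrip H n x₁ x₂ A B) (i : ℤ) : H.Adj (A (i - 1)) (A i) := by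
  simpa using S.aa (i - 1)

theorem bb' (S : IsStrip H n x₁ x₂ A B) (i : ℤ) : H.Adj (B (i - 1)) (B i) := by
  simpa using S.bb (i - 1)

/-- The symmetry of `D n` that exchanges its two poles. -/
theorem swap (S : IsStrip H n x₁ x₂ A B) :
    IsStrip H n x₂ x₁ (fun i => B (-i)) (fun i => A (-i)) where
  pos := S.pos
  perA i := by rw [← S.perB]; congr 1; ring
  perB i := by rw [← S.perA]; congr 1; ring
  va i := S.vb _
  vb i := S.va _
  ab i := (S.ab _).symm
  ba i := by
    rw [show -(i + 1) = -i - 1 by ring]; exact (S.ba' _).symm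
  aa i := by
    rw [show -(i + 1) = -i - 1 by ring]; exact (S.bb' _).symm
  bb i := by
    rw [show -(i + 1) = -i - 1 by ring]; exact (S.aa' _).symm

/-- The symmetry of `D n` that fixes its two poles and reverses the two cycles. -/
theorem reflect (S : IsStrip H n x₁ x₂ A B) :
    IsStrip H n x₁ x₂ (fun i => A (-i)) (fun i => B (-i - 1)) where
  pos := S.pos
  perA i := by rw [← S.perA]; congr 1; ring
  perB i := by rw [← S.perB]; congr 1; ring
  va i := S.va _
  vb i := S.vb _
  ab i := (S.ba' _).symm
  ba i := by
    rw [show -(i + 1) = -i - 1 by ring]; exact (S.ab _).symm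
  aa i := by
    rw [show -(i + 1) = -i - 1 by ring]; exact (S.aa' _).symm
  bb i := by
    rw [show -(i + 1) - 1 = -i - 1 - 1 by ring]; exact (S.bb' _).symm

theorem A_not_adj_add_two (S : IsStrip H n x₁ x₂ A B) (h4 : H.CliqueFree 4) (i : ℤ) :
    ¬ H.Adj (A i) (A (i + 2)) := fun h =>
  no_K4_of_cliqueFree h4 (S.va i) (S.va (i + 1)) (S.va (i + 2)) (S.aa i) h
    (by simpa [add_assoc] using S.aa (i + 1))

theorem A_ne_add_two (S : IsStrip H n x₁ x₂ A B) (h4 : H.CliqueFree 4) (i : ℤ) :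
    A i ≠ A (i + 2) := by
  intro h
  have h1 : H.Adj (A i) (B (i + 1)) := by
    rw [h]
    simpa [add_assoc] using (S.ba (i + 1)).symm
  exact no_K4_of_cliqueFree h4 (S.aa i) (S.ab i) h1 (S.ba i).symm (S.ab (i + 1)) (S.bb i)

theorem A_ne_add_three (S : IsStrip H n x₁ x₂ A B) (h4 : H.CliqueFree 4) (i : ℤ) :
    A i ≠ A (i + 3) := by
  intro h
  refine S.A_not_adj_add_two h4 i ?_
  have := S.aa (i + 2)
  rw [add_assoc, show (2 : ℤ) + 1 = 3 by norm_num, ← h] at this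
  exact this.symm

theorem B_not_adj_add_two (S : IsStrip H n x₁ x₂ A B) (h4 : H.CliqueFree 4) (i : ℤ) :
    ¬ H.Adj (B i) (B (i + 2)) := fun h =>
  no_K4_of_cliqueFree h4 (S.vb i) (S.vb (i + 1)) (S.vb (i + 2)) (S.bb i) h
    (by simpa [add_assoc] using S.bb (i + 1))

theorem B_ne_add_two (S : IsStrip H n x₁ x₂ A B) (h4 : H.CliqueFree 4) (i : ℤ) :
    B i ≠ B (i + 2) := by
  have := S.swap.A_ne_add_two h4 (-i - 2)
  simp only [neg_sub, neg_add_rev, sub_neg_eq_add] at this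
  intro h
  apply this
  rw [show 2 + i = i + 2 by ring, ← h]
  congr 1
  ring

theorem B_ne_A_sub_one (S : IsStrip H n x₁ x₂ A B) (h4 : H.CliqueFree 4) (i : ℤ) :
    B i ≠ A (i - 1) := by
  intro h
  apply S.A_not_adj_add_two h4 (i - 1)
  rw [← h, show i - 1 + 2 = i + 1 by ring]
  exact S.ba i

theorem B_sub_one_ne_A_add_one (S : IsStrip H n x₁ x₂ A B) (h4 : H.CliqueFree 4) (i : ℤ) :
    B (i - 1) ≠ A (i + 1) := by
  intro h
  apply S.A_not_adj_add_two h4 (i - 1)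
  rw [show i - 1 + 2 = i + 1 by ring, ← h]
  exact S.ab _

theorem x₁_ne_B (S : IsStrip H n x₁ x₂ A B) (h4 : H.CliqueFree 4) (i : ℤ) : x₁ ≠ B i := by
  rintro rfl
  exact no_K4_of_cliqueFree h4 (S.va (i + 1)) (S.va (i + 1 + 1)) (S.bb i) (S.aa _) (S.ab _)
    (S.ba _).symm

theorem x₂_ne_A (S : IsStrip H n x₁ x₂ A B) (h4 : H.CliqueFree 4) (i : ℤ) : x₂ ≠ A i := by
  simpa using S.swap.x₁_ne_B h4 (-i)

theorem x₁_ne_x₂ (S : IsStrip H n x₁ x₂ A B) (h4 : H.CliqueFree 4) : x₁ ≠ x₂ := by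
  rintro rfl
  exact no_K4_of_cliqueFree h4 (S.va 0) (S.va (0 + 1)) (S.vb 0) (S.aa 0) (S.ab 0) (S.ba 0).symm

/-- The neighbours `x₁, A (i+1), B i, B (i-1), A (i-1)` of `A i` form a cycle. A connected set that
contains `x₂`, avoids this wheel, and is joined to its hub `A i` and to the path
`A (i-1), x₁, A (i+1)` of its rim, would complete a `K₅` minor. -/
theorem wheel_separates (S : IsStrip H n x₁ x₂ A B) (h4 : H.CliqueFree 4)
    (h5 : ¬ IsMinor (⊤ : SimpleGraph (Fin 5)) H) {i : ℤ} {K : Set V}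
    (hK : (H.induce K).Connected) (hx₂ : x₂ ∈ K) (hx₁ : x₁ ∉ K) (hA : A i ∉ K)
    (hA' : A (i + 1) ∉ K) (hA'' : A (i - 1) ∉ K) (hB : B i ∉ K) (hB' : B (i - 1) ∉ K)
    (hadj : ∃ y ∈ K, H.Adj (A i) y)
    (hrim : ∃ y ∈ K, H.Adj y x₁ ∨ H.Adj y (A (i + 1)) ∨ H.Adj y (A (i - 1))) : False := by
  have hL : (H.induce {A (i - 1), x₁, A (i + 1)}).Connected :=
    connected_induce_insert (SimpleGraph.induce_pair_connected_of_adj (S.va _))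
      (Set.mem_insert _ _) (S.va _).symm
  refine h5 (isMinor_top_of_triangle (p := A i) (q := B i) (r := B (i - 1)) hK hL ?_ hA hB hB'
    ?_ ?_ ?_ (S.ab i) (S.ba' i).symm (S.bb' i).symm hadj ⟨x₂, hx₂, (S.vb _).symm⟩
    ⟨x₂, hx₂, (S.vb _).symm⟩ ⟨x₁, by simp, (S.va _).symm⟩ ⟨A (i + 1), by simp, S.ba i⟩
    ⟨A (i - 1), by simp, (S.ab _).symm⟩ ?_)
  · rw [Set.disjoint_right]
    rintro y (rfl | rfl | rfl) <;> assumption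
  · rintro (h | h | h)
    · exact (S.aa' i).ne h.symm
    · exact (S.va i).ne h.symm
    · exact (S.aa i).ne h
  · rintro (h | h | h)
    · exact S.B_ne_A_sub_one h4 i h
    · exact S.x₁_ne_B h4 i h.symm
    · exact (S.ba i).ne h
  · rintro (h | h | h)
    · exact (S.ab (i - 1)).ne h.symm
    · exact S.x₁_ne_B h4 _ h.symm
    · exact S.B_sub_one_ne_A_add_one h4 i h
  · obtain ⟨y, hy, h | h | h⟩ := hrim
    · exact ⟨y, hy, x₁, by simp, h⟩
    · exact ⟨y, hy, _, by simp, h⟩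
    · exact ⟨y, hy, _, by simp, h⟩

/-- One half of the reason why the sequences `A` and `B` are disjoint; the other half is its mirror
image. -/
theorem next_mem_of_A_eq_B (S : IsStrip H n x₁ x₂ A B) (h4 : H.CliqueFree 4)
    (h5 : ¬ IsMinor (⊤ : SimpleGraph (Fin 5)) H) {j k : ℤ} (h : A j = B k) :
    (B (k + 1) = B j ∨ B (k + 1) = B (j - 1)) ∨ (A (k + 1) = B j ∨ A (k + 1) = B (j - 1)) := by
  by_contra! hne
  obtain ⟨⟨hB, hB'⟩, hA, hA'⟩ := hne
  have hx : H.Adj (A j) x₂ := by rw [h]; exact (S.vb k).symm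
  have hAB : A j ≠ B (k + 1) := by rw [h]; exact (S.bb k).ne
  have hAA : A j ≠ A (k + 1) := by rw [h]; exact (S.ba k).ne
  by_cases hc : B (k + 1) = A (j + 1) ∨ B (k + 1) = A (j - 1)
  · refine S.wheel_separates h4 h5 (i := j) (K := {x₂}) (connected_induce_singleton x₂) rfl
      (S.x₁_ne_x₂ h4) (S.x₂_ne_A h4 _).symm (S.x₂_ne_A h4 _).symm (S.x₂_ne_A h4 _).symm
      (S.vb _).ne' (S.vb _).ne' ⟨x₂, rfl, hx⟩ ⟨x₂, rfl, Or.inr ?_⟩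
    rcases hc with hc | hc
    · exact Or.inl (hc ▸ S.vb _)
    · exact Or.inr (hc ▸ S.vb _)
  push Not at hc
  have hK₂ : (H.induce {B (k + 1), x₂}).Connected :=
    SimpleGraph.induce_pair_connected_of_adj (S.vb _).symm
  by_cases hd : A (k + 1) = A (j + 1) ∨ A (k + 1) = A (j - 1)
  · refine S.wheel_separates h4 h5 (i := j) hK₂ (by simp)
      (by simp [S.x₁_ne_x₂ h4, S.x₁_ne_B h4]) (by simp [hAB, (S.x₂_ne_A h4 _).symm])
      (by simp [hc.1.symm, (S.x₂_ne_A h4 _).symm]) (by simp [hc.2.symm, (S.x₂_ne_A h4 _).symm])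
      (by simp [hB.symm, (S.vb _).ne']) (by simp [hB'.symm, (S.vb _).ne'])
      ⟨x₂, by simp, hx⟩ ⟨B (k + 1), by simp, Or.inr ?_⟩
    rcases hd with hd | hd
    · exact Or.inl (hd ▸ (S.ab _).symm)
    · exact Or.inr (hd ▸ (S.ab _).symm)
  push Not at hd
  exact S.wheel_separates h4 h5 (i := j) (K := {A (k + 1), B (k + 1), x₂})
    (connected_induce_insert hK₂ (by simp) (S.ab _)) (by simp)
    (by simp [S.x₁_ne_x₂ h4, S.x₁_ne_B h4, (S.va _).ne])
    (by simp [hAB, hAA, (S.x₂_ne_A h4 _).symm])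
    (by simp [hc.1.symm, hd.1.symm, (S.x₂_ne_A h4 _).symm])
    (by simp [hc.2.symm, hd.2.symm, (S.x₂_ne_A h4 _).symm])
    (by simp [hB.symm, hA.symm, (S.vb _).ne']) (by simp [hB'.symm, hA'.symm, (S.vb _).ne'])
    ⟨x₂, by simp, hx⟩ ⟨A (k + 1), by simp, Or.inl (S.va _).symm⟩

theorem A_ne_B (S : IsStrip H n x₁ x₂ A B) (h4 : H.CliqueFree 4)
    (h5 : ¬ IsMinor (⊤ : SimpleGraph (Fin 5)) H) (j k : ℤ) : A j ≠ B k := by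
  intro h
  have hnext := S.next_mem_of_A_eq_B h4 h5 h
  have hprev := S.reflect.next_mem_of_A_eq_B h4 h5 (j := -j) (k := -k - 1)
    (by simpa using h)
  simp only [show -(-k - 1 + 1) = k by ring, show -(-j) - 1 = j - 1 by ring,
    show -(-j - 1) - 1 = j by ring] at hprev
  -- Two different ones of `B j`, `B (j - 1)` are adjacent.
  have hP : ∀ y z, (y = B j ∨ y = B (j - 1)) → (z = B j ∨ z = B (j - 1)) → y ≠ z → H.Adj y z := by
    rintro y z (rfl | rfl) (rfl | rfl) hyz
    · exact absurd rfl hyz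
    · exact (S.bb' j).symm
    · exact S.bb' j
    · exact absurd rfl hyz
  have hx : ∀ y, (y = B j ∨ y = B (j - 1)) → H.Adj x₂ y := by
    rintro y (rfl | rfl) <;> exact S.vb _
  -- In each of the four cases there is a `K₄`.
  rcases hnext with hn | hn <;> rcases hprev with hp | hp
  · have h1 := hP _ _ hp.symm hn (by
      have := S.B_ne_add_two h4 (k - 1)
      rwa [show k - 1 + 2 = k + 1 by ring] at this)
    have := S.B_not_adj_add_two h4 (k - 1)
    rw [show k - 1 + 2 = k + 1 by ring] at this
    exact this h1
  · have h1 := hP _ _ hp.symm hn (by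
      have := S.B_ne_A_sub_one h4 (k + 1)
      rw [add_sub_cancel_right] at this
      exact this.symm)
    exact no_K4_of_cliqueFree h4 (S.aa k) (S.ab k) h1 (S.ba k).symm (S.ab _) (S.bb k)
  · have h1 := hP _ _ hp.symm hn (S.B_sub_one_ne_A_add_one h4 k)
    exact no_K4_of_cliqueFree h4 (S.ba' k) h1 (S.bb' k) (S.aa k) (S.ab k) (S.ba k).symm
  · exact no_K4_of_cliqueFree h4 (hx _ hp.symm) (hx _ hn) (S.vb k) (S.aa k) (S.ab k) (S.ba k).symm

end IsStrip

/-! ### Adjacency and periods in homomorphic images of `D n` -/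

namespace IsStrip

variable {V : Type*} {H : SimpleGraph V} {n : ℕ} {x₁ x₂ : V} {A B : ℤ → V}

theorem B_eq_of_adj (S : IsStrip H n x₁ x₂ A B) (h4 : H.CliqueFree 4)
    (h5 : ¬ IsMinor (⊤ : SimpleGraph (Fin 5)) H) {i j : ℤ} (h : H.Adj (A i) (B j)) :
    B j = B i ∨ B j = B (i - 1) := by
  by_contra! hne
  have hd := S.A_ne_B h4 h5
  -- One of the two neighbours of `B j` in the sequence `A` differs from `A i`.
  obtain ⟨k, hk, hki⟩ : ∃ k, H.Adj (A k) (B j) ∧ A k ≠ A i := by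
    by_cases hj : A j = A i
    · exact ⟨j + 1, (S.ba j).symm, fun h' => (S.aa j).ne (hj.trans h'.symm)⟩
    · exact ⟨j, S.ab j, hj⟩
  have hK₂ : (H.induce {B j, x₂}).Connected :=
    SimpleGraph.induce_pair_connected_of_adj (S.vb _).symm
  by_cases hc : A k = A (i + 1) ∨ A k = A (i - 1)
  · refine S.wheel_separates h4 h5 (i := i) hK₂ (by simp)
      (by simp [S.x₁_ne_x₂ h4, S.x₁_ne_B h4]) (by simp [hd, (S.x₂_ne_A h4 _).symm])
      (by simp [hd, (S.x₂_ne_A h4 _).symm]) (by simp [hd, (S.x₂_ne_A h4 _).symm])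
      (by simp [hne.1.symm, (S.vb _).ne']) (by simp [hne.2.symm, (S.vb _).ne'])
      ⟨B j, by simp, h⟩ ⟨B j, by simp, Or.inr ?_⟩
    rcases hc with hc | hc
    · exact Or.inl (hc ▸ hk.symm)
    · exact Or.inr (hc ▸ hk.symm)
  push Not at hc
  exact S.wheel_separates h4 h5 (i := i) (K := {A k, B j, x₂})
    (connected_induce_insert hK₂ (by simp) hk) (by simp)
    (by simp [S.x₁_ne_x₂ h4, S.x₁_ne_B h4, (S.va _).ne])
    (by simp [hd, hki.symm, (S.x₂_ne_A h4 _).symm])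
    (by simp [hd, hc.1.symm, (S.x₂_ne_A h4 _).symm])
    (by simp [hd, hc.2.symm, (S.x₂_ne_A h4 _).symm])
    (by simp [hne.1.symm, (hd _ _).symm, (S.vb _).ne'])
    (by simp [hne.2.symm, (hd _ _).symm, (S.vb _).ne'])
    ⟨B j, by simp, h⟩ ⟨A k, by simp, Or.inl (S.va _).symm⟩

theorem A_eq_of_adj_B (S : IsStrip H n x₁ x₂ A B) (h4 : H.CliqueFree 4)
    (h5 : ¬ IsMinor (⊤ : SimpleGraph (Fin 5)) H) {i j : ℤ} (h : H.Adj (A i) (B j)) :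
    A i = A j ∨ A i = A (j + 1) := by
  have := S.swap.B_eq_of_adj h4 h5 (i := -j) (j := -i) (by simpa using h.symm)
  simpa [add_comm] using this

theorem A_eq_of_adj (S : IsStrip H n x₁ x₂ A B) (h4 : H.CliqueFree 4)
    (h5 : ¬ IsMinor (⊤ : SimpleGraph (Fin 5)) H) {i j : ℤ} (h : H.Adj (A i) (A j)) :
    A j = A (i + 1) ∨ A j = A (i - 1) := by
  by_contra! hne
  have hd := S.A_ne_B h4 h5
  have hBi : B j ≠ B i := fun hB => by
    rcases S.A_eq_of_adj_B h4 h5 (hB ▸ S.ab j) with h' | h'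
    · exact h.ne h'.symm
    · exact hne.1 h'
  have hBi' : B j ≠ B (i - 1) := fun hB => by
    rcases S.A_eq_of_adj_B h4 h5 (hB ▸ S.ab j) with h' | h'
    · exact hne.2 h'
    · exact h.ne (by simpa using h'.symm)
  have hK₂ : (H.induce {B j, x₂}).Connected :=
    SimpleGraph.induce_pair_connected_of_adj (S.vb _).symm
  exact S.wheel_separates h4 h5 (i := i) (K := {A j, B j, x₂})
    (connected_induce_insert hK₂ (by simp) (S.ab _)) (by simp)
    (by simp [S.x₁_ne_x₂ h4, S.x₁_ne_B h4, (S.va _).ne])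
    (by simp [hd, h.ne, (S.x₂_ne_A h4 _).symm])
    (by simp [hd, hne.1.symm, (S.x₂_ne_A h4 _).symm])
    (by simp [hd, hne.2.symm, (S.x₂_ne_A h4 _).symm])
    (by simp [hBi.symm, (hd _ _).symm, (S.vb _).ne'])
    (by simp [hBi'.symm, (hd _ _).symm, (S.vb _).ne'])
    ⟨A j, by simp, h⟩ ⟨A j, by simp, Or.inl (S.va _).symm⟩

theorem B_eq_of_adj_B (S : IsStrip H n x₁ x₂ A B) (h4 : H.CliqueFree 4)
    (h5 : ¬ IsMinor (⊤ : SimpleGraph (Fin 5)) H) {i j : ℤ} (h : H.Adj (B i) (B j)) :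
    B j = B (i + 1) ∨ B j = B (i - 1) := by
  have := S.swap.A_eq_of_adj h4 h5 (i := -i) (j := -j) (by simpa using h)
  simp only [neg_neg, show -(-i + 1) = i - 1 by ring, show -(-i - 1) = i + 1 by ring] at this
  exact this.symm

/-- If `A i = A j`, then the strip passes through this vertex both times along the same pair of
vertices `B`, in the same or in the opposite direction. -/
theorem B_eq_or_reversed (S : IsStrip H n x₁ x₂ A B) (h4 : H.CliqueFree 4)
    (h5 : ¬ IsMinor (⊤ : SimpleGraph (Fin 5)) H) {i j : ℤ} (h : A i = A j) :
    (B j = B i ∧ B (j - 1) = B (i - 1)) ∨ (B j = B (i - 1) ∧ B (j - 1) = B i) := by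
  have h1 := S.B_eq_of_adj h4 h5 (h ▸ S.ab j)
  have h2 := S.B_eq_of_adj h4 h5 (h ▸ (S.ba' j).symm)
  have h3 := (S.bb' j).ne
  rcases h1 with h1 | h1 <;> rcases h2 with h2 | h2
  · exact absurd (h2.trans h1.symm) h3
  · exact Or.inl ⟨h1, h2⟩
  · exact Or.inr ⟨h1, h2⟩
  · exact absurd (h2.trans h1.symm) h3

/-- The opposite direction does not occur: such a reversal would persist along the strip, and the
two passages would meet where `i - j` is `0` or `1`. -/
theorem not_reversed (S : IsStrip H n x₁ x₂ A B) (h4 : H.CliqueFree 4)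
    (h5 : ¬ IsMinor (⊤ : SimpleGraph (Fin 5)) H) (i j : ℤ) :
    ¬ (A i = A j ∧ B j = B (i - 1) ∧ B (j - 1) = B i) := by
  suffices ∀ (d : ℕ) (i j : ℤ), i - j = d → ¬ (A i = A j ∧ B j = B (i - 1) ∧ B (j - 1) = B i) by
    intro h
    rcases le_total j i with hij | hij
    · exact this (i - j).toNat i j (by omega) h
    · exact this (j - i).toNat j i (by omega) ⟨h.1.symm, h.2.2.symm, h.2.1.symm⟩
  intro d
  induction d using Nat.strong_induction_on with
  | _ d ih =>
    rintro i j hd ⟨hA, hB, hB'⟩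
    have hd01 : d = 0 ∨ d = 1 ∨ 2 ≤ d := by omega
    rcases hd01 with rfl | rfl | h2
    · obtain rfl : i = j := by omega
      exact (S.bb' i).ne hB.symm
    · obtain rfl : i = j + 1 := by omega
      exact (S.aa j).ne hA.symm
    · have hA' : A (i - 1) = A (j + 1) := by
        rcases S.A_eq_of_adj_B h4 h5 (hB ▸ (S.ba j).symm) with h | h
        · exact h.symm
        · rw [sub_add_cancel, hA] at h
          exact absurd h.symm (S.aa j).ne
      refine ih (d - 2) (by omega) (i - 1) (j + 1) (by omega) ⟨hA', ?_⟩
      rcases S.B_eq_or_reversed h4 h5 hA' with ⟨h, h'⟩ | h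
      · rw [add_sub_cancel_right, hB] at h'
        exact absurd h'.symm (S.bb' (i - 1)).ne
      · exact h

theorem B_eq_of_A_eq (S : IsStrip H n x₁ x₂ A B) (h4 : H.CliqueFree 4)
    (h5 : ¬ IsMinor (⊤ : SimpleGraph (Fin 5)) H) {i j : ℤ} (h : A i = A j) :
    B i = B j ∧ B (i - 1) = B (j - 1) := by
  rcases S.B_eq_or_reversed h4 h5 h with h' | h'
  · exact ⟨h'.1.symm, h'.2.symm⟩
  · exact absurd ⟨h, h'⟩ (S.not_reversed h4 h5 i j)

theorem A_eq_of_B_eq (S : IsStrip H n x₁ x₂ A B) (h4 : H.CliqueFree 4)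
    (h5 : ¬ IsMinor (⊤ : SimpleGraph (Fin 5)) H) {i j : ℤ} (h : B i = B j) :
    A i = A j ∧ A (i + 1) = A (j + 1) := by
  have := S.swap.B_eq_of_A_eq h4 h5 (i := -i) (j := -j) (by simpa using h)
  simpa [add_comm] using this

theorem A_add_eq (S : IsStrip H n x₁ x₂ A B) (h4 : H.CliqueFree 4)
    (h5 : ¬ IsMinor (⊤ : SimpleGraph (Fin 5)) H) {i j : ℤ} (h : A i = A j) (k : ℤ) :
    A (i + k) = A (j + k) := by
  induction k with
  | zero => simpa using h
  | succ k ih =>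
    rw [← add_assoc, ← add_assoc]
    exact (S.A_eq_of_B_eq h4 h5 (S.B_eq_of_A_eq h4 h5 ih).1).2
  | pred k ih =>
    have := (S.A_eq_of_B_eq h4 h5 (S.B_eq_of_A_eq h4 h5 ih).2).1
    rwa [add_sub_assoc, add_sub_assoc] at this

/-- Both sequences are periodic with the same exact period. -/
theorem exists_period (S : IsStrip H n x₁ x₂ A B) (h4 : H.CliqueFree 4)
    (h5 : ¬ IsMinor (⊤ : SimpleGraph (Fin 5)) H) :
    ∃ m : ℕ, 4 ≤ m ∧ m ∣ n ∧ (∀ i j, A i = A j ↔ (m : ℤ) ∣ i - j) ∧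
      ∀ i j, B i = B j ↔ (m : ℤ) ∣ i - j := by
  classical
  have hex : ∃ m : ℕ, 0 < m ∧ A m = A 0 := ⟨n, S.pos, by simpa using S.perA 0⟩
  obtain ⟨hpos, hm⟩ := Nat.find_spec hex
  have hmin := fun k => Nat.find_min hex (m := k)
  set m := Nat.find hex
  have hper : Function.Periodic A m := fun k => by
    have := S.A_add_eq h4 h5 hm k
    rwa [zero_add, add_comm] at this
  have hA : ∀ i j, A i = A j ↔ (m : ℤ) ∣ i - j := by
    intro i j
    constructor
    · intro h
      have h0 : A (i - j) = A 0 := by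
        simpa [sub_eq_add_neg] using S.A_add_eq h4 h5 h (-j)
      have hr : A ((i - j) % m) = A 0 := by
        rw [← h0, Int.emod_def, mul_comm]
        exact (hper.int_mul ((i - j) / m)).sub_eq (i - j)
      have hr0 := Int.emod_nonneg (i - j) (b := m) (by omega)
      have hrm := Int.emod_lt_of_pos (i - j) (b := m) (by omega)
      by_contra hdvd
      have hne : (i - j) % m ≠ 0 := fun h' => hdvd (Int.dvd_of_emod_eq_zero h')
      refine hmin ((i - j) % m).toNat (by omega) ⟨by omega, ?_⟩
      rwa [Int.toNat_of_nonneg hr0]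
    · rintro ⟨q, hq⟩
      rw [show i = j + q * m by linear_combination hq]
      exact hper.int_mul q j
  refine ⟨m, ?_, ?_, hA, fun i j => ?_⟩
  · have h1 : m ≠ 1 := fun h => (S.aa 0).ne (by rw [h] at hm; simpa using hm.symm)
    have h2 : m ≠ 2 := fun h => S.A_ne_add_two h4 0 (by rw [h] at hm; simpa using hm.symm)
    have h3 : m ≠ 3 := fun h => S.A_ne_add_three h4 0 (by rw [h] at hm; simpa using hm.symm)
    omega
  · have := (hA n 0).1 (by simpa using S.perA 0)
    rw [sub_zero] at this
    exact_mod_cast this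
  · rw [← hA]
    exact ⟨fun h => (S.A_eq_of_B_eq h4 h5 h).1, fun h => (S.B_eq_of_A_eq h4 h5 h).1⟩

/-- The cycle of the vertices `A i` separates `x₁` from the rest of the strip: it would otherwise
extend to a `K₅` minor. -/
theorem cycle_separates (S : IsStrip H n x₁ x₂ A B) (h4 : H.CliqueFree 4)
    (h5 : ¬ IsMinor (⊤ : SimpleGraph (Fin 5)) H) {K : Set V} (hK : (H.induce K).Connected)
    (hB : ∀ i, B i ∈ K) (hA : ∀ i, A i ∉ K) (hx₁ : x₁ ∉ K) {y : V} (hy : y ∈ K) :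
    ¬ H.Adj x₁ y := by
  intro hadj
  obtain ⟨m, hm4, -, hper, -⟩ := S.exists_period h4 h5
  have hL : ∀ k : ℤ, 2 ≤ k → (H.induce (A '' Set.Icc 2 k)).Connected := by
    intro k hk
    induction k, hk using Int.leInduction with
    | base =>
      rw [Set.Icc_self, Set.image_singleton]
      exact connected_induce_singleton _
    | succ k hk ih =>
      have : A '' Set.Icc 2 (k + 1) = insert (A (k + 1)) (A '' Set.Icc 2 k) := by
        rw [← Set.image_insert_eq]
        congr 1
        ext z
        simp only [Set.mem_Icc, Set.mem_insert_iff]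
        omega
      rw [this]
      exact connected_induce_insert ih ⟨k, ⟨hk, le_rfl⟩, rfl⟩ (S.aa k).symm
  have hnot : ∀ i : ℤ, i = 0 ∨ i = 1 → A i ∉ A '' Set.Icc 2 ((m : ℤ) - 1) := by
    rintro i hi ⟨k, ⟨hk2, hkm⟩, hk⟩
    have h1 := Int.le_of_dvd (by omega) ((hper k i).1 hk)
    omega
  refine h5 (isMinor_top_of_triangle (p := x₁) (q := A 0) (r := A 1) hK
    (hL (m - 1) (by omega)) ?_ hx₁ (hA 0) (hA 1) ?_ (hnot 0 (by simp)) (hnot 1 (by simp))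
    (S.va 0) (S.va 1) (S.aa 0) ⟨y, hy, hadj⟩ ⟨B 0, hB 0, S.ab 0⟩ ⟨B 1, hB 1, S.ab 1⟩
    ⟨A 2, ⟨2, ⟨le_rfl, by omega⟩, rfl⟩, S.va 2⟩
    ⟨A (m - 1), ⟨m - 1, ⟨by omega, le_rfl⟩, rfl⟩, ?_⟩
    ⟨A 2, ⟨2, ⟨le_rfl, by omega⟩, rfl⟩, S.aa 1⟩
    ⟨B 2, hB 2, A 2, ⟨2, ⟨le_rfl, by omega⟩, rfl⟩, (S.ab 2).symm⟩)
  · rw [Set.disjoint_right]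
    rintro _ ⟨k, -, rfl⟩
    exact hA k
  · rintro ⟨k, -, hk⟩
    exact (S.va k).ne hk.symm
  · rw [(hper 0 m).2 (by simp)]
    exact (S.aa' m).symm

theorem connected_B (S : IsStrip H n x₁ x₂ A B) :
    (H.induce (insert x₂ (Set.range B))).Connected := by
  refine SimpleGraph.induce_connected_of_patches x₂ (Set.mem_insert _ _) ?_
  rintro v (rfl | ⟨i, rfl⟩)
  · exact ⟨{v}, by simp, rfl, rfl, SimpleGraph.Reachable.rfl⟩
  · exact ⟨{x₂, B i}, Set.insert_subset_insert (by simp), by simp, by simp,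
      (SimpleGraph.induce_pair_connected_of_adj (S.vb i)).preconnected _ _⟩

theorem not_adj_x₁ (S : IsStrip H n x₁ x₂ A B) (h4 : H.CliqueFree 4)
    (h5 : ¬ IsMinor (⊤ : SimpleGraph (Fin 5)) H) : ¬ H.Adj x₁ x₂ ∧ ∀ i, ¬ H.Adj x₁ (B i) := by
  have := fun y => S.cycle_separates h4 h5 (y := y) S.connected_B
    (fun i => by simp)
    (fun i => by simpa [(S.x₂_ne_A h4 _).symm] using fun k => (S.A_ne_B h4 h5 i k).symm)
    (by simpa [S.x₁_ne_x₂ h4] using fun k => (S.x₁_ne_B h4 k).symm)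
  exact ⟨this _ (by simp), fun i => this _ (by simp)⟩

theorem not_adj_x₂ (S : IsStrip H n x₁ x₂ A B) (h4 : H.CliqueFree 4)
    (h5 : ¬ IsMinor (⊤ : SimpleGraph (Fin 5)) H) (i : ℤ) : ¬ H.Adj x₂ (A i) := by
  simpa using (S.swap.not_adj_x₁ h4 h5).2 (-i)

/-- A path `x₁, a, b, x₂` of `H` meets the strip in some `A i` and, dually, in some `B j`. -/
theorem exists_eq_A (S : IsStrip H n x₁ x₂ A B) (h4 : H.CliqueFree 4)
    (h5 : ¬ IsMinor (⊤ : SimpleGraph (Fin 5)) H) {a b : V} (ha : H.Adj x₁ a) (hab : H.Adj a b)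
    (hb : H.Adj b x₂) : ∃ i, a = A i := by
  by_contra! hne
  have hb' : ∀ i, A i ≠ b := by
    rintro i rfl
    exact S.not_adj_x₂ h4 h5 i hb.symm
  have hx : x₁ ≠ b := by
    rintro rfl
    exact (S.not_adj_x₁ h4 h5).1 hb
  refine S.cycle_separates h4 h5 (y := a)
    (connected_induce_insert (connected_induce_insert S.connected_B (Set.mem_insert _ _) hb)
      (Set.mem_insert _ _) hab) (fun i => by simp) (fun i => ?_) ?_ (Set.mem_insert _ _) ha
  · simpa [(S.x₂_ne_A h4 _).symm, hb', (hne i).symm] using fun k => (S.A_ne_B h4 h5 i k).symm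
  · simpa [S.x₁_ne_x₂ h4, hx, ha.ne] using fun k => (S.x₁_ne_B h4 k).symm

theorem exists_eq_B (S : IsStrip H n x₁ x₂ A B) (h4 : H.CliqueFree 4)
    (h5 : ¬ IsMinor (⊤ : SimpleGraph (Fin 5)) H) {a b : V} (ha : H.Adj x₁ a) (hab : H.Adj a b)
    (hb : H.Adj b x₂) : ∃ i, b = B i := by
  obtain ⟨i, hi⟩ := S.swap.exists_eq_A h4 h5 hb.symm hab.symm ha.symm
  exact ⟨-i, hi⟩

theorem models_phi {V : Type u} {H : SimpleGraph V} {x₁ x₂ : V} {A B : ℤ → V}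
    (S : IsStrip H n x₁ x₂ A B) (h4 : H.CliqueFree 4)
    (h5 : ¬ IsMinor (⊤ : SimpleGraph (Fin 5)) H) : Models H phi := by
  rw [PlanarHPP.models_phi]
  refine ⟨x₁, x₂, A 0, B 0, S.va 0, S.ab 0, (S.vb 0).symm, ?_⟩
  rintro a b ⟨ha, hab, hb⟩
  obtain ⟨i, rfl⟩ := S.exists_eq_A h4 h5 ha hab hb
  obtain ⟨j, rfl⟩ := S.exists_eq_B h4 h5 ha hab hb
  rcases S.B_eq_of_adj h4 h5 hab with hj | hj <;> rw [hj]
  · exact ⟨A (i + 1), B (i + 1), S.va _, S.aa _, S.ba _, S.bb _, S.ab _, (S.vb _).symm⟩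
  · exact ⟨A (i - 1), B (i - 1 - 1), S.va _, (S.aa' _).symm, (S.ab _).symm, (S.bb' _).symm,
      (S.ba' _).symm, (S.vb _).symm⟩

/-- The image of a strip of exact period `m` is an induced copy of `D m`. -/
theorem exists_embedding (S : IsStrip H n x₁ x₂ A B) (h4 : H.CliqueFree 4)
    (h5 : ¬ IsMinor (⊤ : SimpleGraph (Fin 5)) H) :
    ∃ m : ℕ, 4 ≤ m ∧ m ∣ n ∧ Nonempty (D m ↪g H) := by
  obtain ⟨m, hm4, hmn, hperA, hperB⟩ := S.exists_period h4 h5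
  refine ⟨m, hm4, hmn, ?_⟩
  have : NeZero m := ⟨by omega⟩
  have hdvd : ∀ (x y : ZMod m) (d : ℤ), (m : ℤ) ∣ x.val - (y.val + d) ↔ x = y + d := by
    intro x y d
    rw [← ZMod.intCast_zmod_eq_zero_iff_dvd]
    push_cast
    simp [sub_eq_zero]
  have hA : ∀ (x y : ZMod m) (d : ℤ), A x.val = A (y.val + d) ↔ x = y + d := fun x y d => by
    rw [hperA, hdvd]
  have hB : ∀ (x y : ZMod m) (d : ℤ), B x.val = B (y.val + d) ↔ x = y + d := fun x y d => by
    rw [hperB, hdvd]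
  let f : DVertex m → V := fun v => match v with
    | .v₁ => x₁
    | .v₂ => x₂
    | .a i => A (i : ℕ)
    | .b i => B (i : ℕ)
  have fA : ∀ x : ZMod m, f (cycA x) = A x.val := fun _ => rfl
  have fB : ∀ x : ZMod m, f (cycB x) = B x.val := fun _ => rfl
  have f₁ : f .v₁ = x₁ := rfl
  have f₂ : f .v₂ = x₂ := rfl
  have iA : ∀ x y : ZMod m, A x.val = A y.val ↔ x = y := fun x y => by simpa using hA x y 0
  have iB : ∀ x y : ZMod m, B x.val = B y.val ↔ x = y := fun x y => by simpa using hB x y 0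
  have eAA : ∀ x y : ZMod m, H.Adj (A x.val) (A y.val) ↔ y = x + 1 ∨ x = y + 1 := by
    intro x y
    constructor
    · intro h
      rcases S.A_eq_of_adj h4 h5 h with h | h
      · exact Or.inl (by simpa using (hA y x 1).1 h)
      · have := (hA y x (-1)).1 (by rwa [← sub_eq_add_neg])
        exact Or.inr (by rw [this]; simp)
    · rintro (h | h)
      · rw [(hA y x 1).2 (by simpa using h)]; exact S.aa _
      · rw [(hA x y 1).2 (by simpa using h)]; exact (S.aa _).symm
  have eBB : ∀ x y : ZMod m, H.Adj (B x.val) (B y.val) ↔ y = x + 1 ∨ x = y + 1 := by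
    intro x y
    constructor
    · intro h
      rcases S.B_eq_of_adj_B h4 h5 h with h | h
      · exact Or.inl (by simpa using (hB y x 1).1 h)
      · have := (hB y x (-1)).1 (by rwa [← sub_eq_add_neg])
        exact Or.inr (by rw [this]; simp)
    · rintro (h | h)
      · rw [(hB y x 1).2 (by simpa using h)]; exact S.bb _
      · rw [(hB x y 1).2 (by simpa using h)]; exact (S.bb _).symm
  have eAB : ∀ x y : ZMod m, H.Adj (A x.val) (B y.val) ↔ x = y ∨ x = y + 1 := by
    intro x y
    constructor
    · intro h
      rcases S.A_eq_of_adj_B h4 h5 h with h | h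
      · exact Or.inl ((iA x y).1 h)
      · exact Or.inr (by simpa using (hA x y 1).1 h)
    · rintro (rfl | h)
      · exact S.ab _
      · rw [(hA x y 1).2 (by simpa using h)]; exact (S.ba _).symm
  obtain ⟨n₁₂, n₁B⟩ := S.not_adj_x₁ h4 h5
  have n₂A := S.not_adj_x₂ h4 h5
  have hm2 : 2 ≤ m := by omega
  refine ⟨⟨⟨f, fun v w h => ?_⟩, fun {v w} => ?_⟩⟩
  · obtain rfl | rfl | ⟨x, rfl⟩ | ⟨x, rfl⟩ := v.cyc_cases <;>
      obtain rfl | rfl | ⟨y, rfl⟩ | ⟨y, rfl⟩ := w.cyc_cases <;>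
      simp only [fA, fB, f₁, f₂] at h
    · rfl
    · exact absurd h (S.x₁_ne_x₂ h4)
    · exact absurd h (S.va _).ne
    · exact absurd h (S.x₁_ne_B h4 _)
    · exact absurd h.symm (S.x₁_ne_x₂ h4)
    · rfl
    · exact absurd h (S.x₂_ne_A h4 _)
    · exact absurd h (S.vb _).ne
    · exact absurd h.symm (S.va _).ne
    · exact absurd h.symm (S.x₂_ne_A h4 _)
    · rw [(iA x y).1 h]
    · exact absurd h (S.A_ne_B h4 h5 _ _)
    · exact absurd h.symm (S.x₁_ne_B h4 _)
    · exact absurd h.symm (S.vb _).ne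
    · exact absurd h.symm (S.A_ne_B h4 h5 _ _)
    · rw [(iB x y).1 h]
  · change H.Adj (f v) (f w) ↔ (D m).Adj v w
    obtain rfl | rfl | ⟨x, rfl⟩ | ⟨x, rfl⟩ := v.cyc_cases <;>
      obtain rfl | rfl | ⟨y, rfl⟩ | ⟨y, rfl⟩ := w.cyc_cases <;>
      simp only [fA, fB, f₁, f₂]
    · simp
    · exact iff_of_false n₁₂ not_D_adj_v₁_v₂
    · exact iff_of_true (S.va _) (D_adj_v₁_cycA _)
    · exact iff_of_false (n₁B _) (not_D_adj_v₁_cycB _)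
    · exact iff_of_false (fun h => n₁₂ h.symm) (fun h => not_D_adj_v₁_v₂ h.symm)
    · simp
    · exact iff_of_false (n₂A _) (not_D_adj_v₂_cycA _)
    · exact iff_of_true (S.vb _) (D_adj_v₂_cycB _)
    · exact iff_of_true (S.va _).symm (D_adj_v₁_cycA _).symm
    · exact iff_of_false (fun h => n₂A _ h.symm) (fun h => not_D_adj_v₂_cycA _ h.symm)
    · rw [eAA, D_adj_cycA_cycA hm2]
    · rw [eAB, D_adj_cycA_cycB]
    · exact iff_of_false (fun h => n₁B _ h.symm) (fun h => not_D_adj_v₁_cycB _ h.symm)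
    · exact iff_of_true (S.vb _).symm (D_adj_v₂_cycB _).symm
    · rw [H.adj_comm, eAB, (D m).adj_comm, D_adj_cycA_cycB]
    · rw [eBB, D_adj_cycB_cycB hm2]

/-- A homomorphism from `D n` gives a strip. -/
theorem of_hom (hn : 2 ≤ n) (f : D n →g H) :
    ∃ x₁ x₂ A B, IsStrip H n x₁ x₂ A B := by
  have : NeZero n := ⟨by omega⟩
  refine ⟨f .v₁, f .v₂, fun k => f (cycA k), fun k => f (cycB k), by omega, fun i => by simp,
    fun i => by simp, fun i => f.map_adj (D_adj_v₁_cycA _), fun i => f.map_adj (D_adj_v₂_cycB _),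
    fun i => f.map_adj (D_adj_cycA_cycB.2 (Or.inl rfl)),
    fun i => f.map_adj (D_adj_cycA_cycB.2 (Or.inr (by simp))).symm,
    fun i => f.map_adj ((D_adj_cycA_cycA hn).2 (Or.inl (by simp))),
    fun i => f.map_adj ((D_adj_cycB_cycB hn).2 (Or.inl (by simp)))⟩

end IsStrip

/-! ### Triangles in the graphs `D n` -/

section Triangles

variable {n : ℕ}

/-- Every edge of `D n` lies in exactly two triangles, whose apexes are not adjacent. -/
theorem D_common_neighbors (hn : 4 ≤ n) {v w : DVertex n} (h : (D n).Adj v w) :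
    ∃ z z', z ≠ z' ∧ ¬ (D n).Adj z z' ∧
      ∀ u, ((D n).Adj v u ∧ (D n).Adj w u) ↔ (u = z ∨ u = z') := by
  have : NeZero n := ⟨by omega⟩
  have hn2 : 2 ≤ n := by omega
  have hcast : ∀ k : ℕ, 0 < k → k < n → (k : ZMod n) ≠ 0 := fun k h0 hk h => by
    rw [ZMod.natCast_eq_zero_iff] at h
    exact absurd (Nat.le_of_dvd h0 h) (by omega)
  have h1 : ∀ x : ZMod n, x ≠ x + 1 := fun x h =>
    hcast 1 (by omega) (by omega) (by push_cast; linear_combination -h)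
  have h2 : ∀ x : ZMod n, x ≠ x + 1 + 1 := fun x h =>
    hcast 2 (by omega) (by omega) (by push_cast; linear_combination -h)
  have h3 : ∀ x : ZMod n, x ≠ x + 1 + 1 + 1 := fun x h =>
    hcast 3 (by omega) (by omega) (by push_cast; linear_combination -h)
  have hAB : ∀ x y : ZMod n, (cycA x : DVertex n) ≠ cycB y := fun x y => by simp [cycA, cycB]
  have h₁A : ∀ x : ZMod n, (.v₁ : DVertex n) ≠ cycA x := fun x => by simp [cycA]
  have h₁B : ∀ x : ZMod n, (.v₁ : DVertex n) ≠ cycB x := fun x => by simp [cycB]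
  have h₂A : ∀ x : ZMod n, (.v₂ : DVertex n) ≠ cycA x := fun x => by simp [cycA]
  have h₂B : ∀ x : ZMod n, (.v₂ : DVertex n) ≠ cycB x := fun x => by simp [cycB]
  have hBA : ∀ x y : ZMod n, (D n).Adj (cycB x) (cycA y) ↔ y = x ∨ y = x + 1 := fun x y => by
    rw [SimpleGraph.adj_comm, D_adj_cycA_cycB]
  have hA₁ : ∀ x : ZMod n, (D n).Adj (cycA x) .v₁ := fun x => (D_adj_v₁_cycA x).symm
  have hB₂ : ∀ x : ZMod n, (D n).Adj (cycB x) .v₂ := fun x => (D_adj_v₂_cycB x).symm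
  have hA₂ : ∀ x : ZMod n, ¬ (D n).Adj (cycA x) .v₂ := fun x h => not_D_adj_v₂_cycA x h.symm
  have hB₁ : ∀ x : ZMod n, ¬ (D n).Adj (cycB x) .v₁ := fun x h => not_D_adj_v₁_cycB x h.symm
  have h₂₁ : ¬ (D n).Adj .v₂ .v₁ := fun h => not_D_adj_v₁_v₂ h.symm
  have hu : ∀ {P : DVertex n → Prop}, P .v₁ → P .v₂ → (∀ x : ZMod n, P (cycA x)) →
      (∀ x : ZMod n, P (cycB x)) → ∀ u, P u := by
    intro P p₁ p₂ pA pB u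
    obtain rfl | rfl | ⟨x, rfl⟩ | ⟨x, rfl⟩ := u.cyc_cases
    exacts [p₁, p₂, pA x, pB x]
  suffices ∀ i : Fin 6 × ZMod n, ∃ z z', z ≠ z' ∧ ¬ (D n).Adj z z' ∧
      ∀ u, ((D n).Adj (edgeEnds i).1 u ∧ (D n).Adj (edgeEnds i).2 u) ↔ (u = z ∨ u = z') by
    obtain ⟨i, hi⟩ := exists_edgeEnds hn2 v w h
    obtain ⟨z, z', hz, hzz, hall⟩ := this i
    refine ⟨z, z', hz, hzz, fun u => ?_⟩
    rw [← hall]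
    rcases Sym2.eq_iff.1 hi with ⟨rfl, rfl⟩ | ⟨rfl, rfl⟩
    · exact Iff.rfl
    · exact and_comm
  rintro ⟨k, x⟩
  obtain ⟨z, rfl⟩ : ∃ z, x = z + 1 := ⟨x - 1, by ring⟩
  clear hcast h v w
  fin_cases k
  · refine ⟨cycA (z + 1 + 1), cycA z, ?_, ?_, hu ?_ ?_ (fun y => ?_) (fun y => ?_)⟩ <;>
      simp [edgeEnds, D_adj_cycA_cycA hn2, cycA_inj, D_adj_v₁_cycA, not_D_adj_v₁_v₂,
        not_D_adj_v₁_cycB, h₁A, h₂A, (hAB _ _).symm] <;>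
      grind
  · refine ⟨.v₁, cycB (z + 1), ?_, ?_, hu ?_ ?_ (fun y => ?_) (fun y => ?_)⟩ <;>
      simp [edgeEnds, D_adj_cycA_cycA hn2, D_adj_cycA_cycB, cycB_inj, not_D_adj_v₁_cycB,
        h₁B, h₂B, hAB, (h₁A _).symm, (h₁B _).symm, hA₁, hA₂] <;>
      grind
  · refine ⟨cycA (z + 1 + 1), cycB z, ?_, ?_, hu ?_ ?_ (fun y => ?_) (fun y => ?_)⟩ <;>
      simp [edgeEnds, D_adj_cycA_cycA hn2, D_adj_cycB_cycB hn2, D_adj_cycA_cycB, cycA_inj,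
        cycB_inj, hBA, h₁A, h₁B, h₂A, h₂B, hAB, (hAB _ _).symm, hA₁, hA₂, hB₁, hB₂] <;>
      grind
  · refine ⟨cycA (z + 1), cycB (z + 1 + 1), ?_, ?_, hu ?_ ?_ (fun y => ?_) (fun y => ?_)⟩ <;>
      simp [edgeEnds, D_adj_cycA_cycA hn2, D_adj_cycB_cycB hn2, D_adj_cycA_cycB, cycA_inj,
        cycB_inj, hBA, h₁A, h₁B, h₂A, h₂B, hAB, (hAB _ _).symm, hA₁, hA₂, hB₁, hB₂] <;>
      grind
  · refine ⟨.v₂, cycA (z + 1 + 1), ?_, ?_, hu ?_ ?_ (fun y => ?_) (fun y => ?_)⟩ <;>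
      simp [edgeEnds, D_adj_cycB_cycB hn2, hBA, cycA_inj, not_D_adj_v₂_cycA, h₁A, h₂A,
        (hAB _ _).symm, (h₂A _).symm, (h₂B _).symm, hB₁, hB₂] <;>
      grind
  · refine ⟨cycB (z + 1 + 1), cycB z, ?_, ?_, hu ?_ ?_ (fun y => ?_) (fun y => ?_)⟩ <;>
      simp [edgeEnds, D_adj_cycB_cycB hn2, cycB_inj, D_adj_v₂_cycB, not_D_adj_v₂_cycA, h₂₁,
        h₁B, h₂B, hAB] <;>
      grind

theorem cliqueFree_D (hn : 4 ≤ n) : (D n).CliqueFree 4 := by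
  by_contra h
  obtain ⟨f⟩ := SimpleGraph.not_cliqueFree_iff_top_isContained _ |>.1 h
  have hf : ∀ i j : Fin 4, i ≠ j → (D n).Adj (f i) (f j) := fun i j hij => f.toHom.map_adj hij
  obtain ⟨z, z', -, hzz, hall⟩ := D_common_neighbors hn (hf 0 1 (by decide))
  have h2 := (hall (f 2)).1 ⟨hf 0 2 (by decide), hf 1 2 (by decide)⟩
  have h3 := (hall (f 3)).1 ⟨hf 0 3 (by decide), hf 1 3 (by decide)⟩
  have h23 := hf 2 3 (by decide)
  rcases h2 with h2 | h2 <;> rcases h3 with h3 | h3 <;> rw [h2, h3] at h23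
  · exact h23.ne rfl
  · exact hzz h23
  · exact hzz h23.symm
  · exact h23.ne rfl

/-- Any two edges of `D n` are linked by a chain of triangles: a set of vertices that contains an
edge, and with every edge the triangles on it, contains everything. -/
theorem eq_univ_of_triangle_closed (hn : 2 ≤ n) {T : Set (DVertex n)}
    (hT : ∀ v w u, v ∈ T → w ∈ T → (D n).Adj v w → (D n).Adj v u → (D n).Adj w u → u ∈ T)
    {v w : DVertex n} (hv : v ∈ T) (hw : w ∈ T) (hvw : (D n).Adj v w) : T = Set.univ := by
  have : NeZero n := ⟨by omega⟩
  have aa : ∀ x : ZMod n, (D n).Adj (cycA x) (cycA (x + 1)) := fun x =>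
    (D_adj_cycA_cycA hn).2 (Or.inl rfl)
  have bb : ∀ x : ZMod n, (D n).Adj (cycB x) (cycB (x + 1)) := fun x =>
    (D_adj_cycB_cycB hn).2 (Or.inl rfl)
  have ab : ∀ x : ZMod n, (D n).Adj (cycA x) (cycB x) := fun x => D_adj_cycA_cycB.2 (Or.inl rfl)
  have ab' : ∀ x : ZMod n, (D n).Adj (cycA (x + 1)) (cycB x) := fun x =>
    D_adj_cycA_cycB.2 (Or.inr rfl)
  have va : ∀ x : ZMod n, (D n).Adj .v₁ (cycA x) := D_adj_v₁_cycA
  have vb : ∀ x : ZMod n, (D n).Adj .v₂ (cycB x) := D_adj_v₂_cycB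
  have s₁ : ∀ x : ZMod n, cycA x ∈ T → cycA (x + 1) ∈ T → .v₁ ∈ T ∧ ∃ x : ZMod n, cycA x ∈ T :=
    fun x h h' => ⟨hT _ _ _ h h' (aa x) (va _).symm (va _).symm, x, h⟩
  have s₃ : ∀ x : ZMod n, cycB x ∈ T → cycA (x + 1) ∈ T → .v₁ ∈ T ∧ ∃ x : ZMod n, cycA x ∈ T :=
    fun x h h' => s₁ x (hT _ _ _ h h' (ab' x).symm (ab x).symm (aa x).symm) h'
  have s₄ : ∀ x : ZMod n, cycB x ∈ T → cycB (x + 1) ∈ T → .v₁ ∈ T ∧ ∃ x : ZMod n, cycA x ∈ T :=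
    fun x h h' => s₃ x h (hT _ _ _ h h' (bb x) (ab' x).symm (ab _).symm)
  have start : .v₁ ∈ T ∧ ∃ x : ZMod n, cycA x ∈ T := by
    obtain ⟨⟨k, x⟩, hi⟩ := exists_edgeEnds hn v w hvw
    have hmem : (edgeEnds (k, x)).1 ∈ T ∧ (edgeEnds (k, x)).2 ∈ T := by
      rcases Sym2.eq_iff.1 hi with ⟨rfl, rfl⟩ | ⟨rfl, rfl⟩
      exacts [⟨hv, hw⟩, ⟨hw, hv⟩]
    obtain ⟨h, h'⟩ := hmem
    fin_cases k
    · exact ⟨h, x, h'⟩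
    · exact s₁ x h h'
    · exact s₁ x h (hT _ _ _ h h' (ab x) (aa x) (ab' x).symm)
    · exact s₃ x h h'
    · exact s₄ x h h'
    · exact s₄ x h (hT _ _ _ h h' (vb x).symm (bb x) (vb _))
  obtain ⟨h₁, x, hx⟩ := start
  have hAadd : ∀ k : ℕ, cycA (x + (k : ZMod n)) ∈ T := by
    intro k
    induction k with
    | zero => simpa using hx
    | succ k ih =>
      rw [Nat.cast_succ, ← add_assoc]
      exact hT _ _ _ h₁ ih (va _) (va _) (aa _)
  have hA : ∀ y : ZMod n, cycA y ∈ T := fun y => by simpa using hAadd (y - x).val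
  have hB : ∀ y : ZMod n, cycB y ∈ T := fun y =>
    hT _ _ _ (hA y) (hA (y + 1)) (aa y) (ab y) (ab' y)
  rw [Set.eq_univ_iff_forall]
  intro u
  obtain rfl | rfl | ⟨y, rfl⟩ | ⟨y, rfl⟩ := u.cyc_cases
  exacts [h₁, hT _ _ _ (hB 0) (hB (0 + 1)) (bb 0) (vb _).symm (vb _).symm, hA y, hB y]

/-- No graph `D m` is a proper induced subgraph of `D n`: both triangles of `D n` on an edge in the
image of `D m` belong to the image. -/
theorem embedding_surjective {m : ℕ} (hm : 4 ≤ m) (hn : 4 ≤ n) (e : D m ↪g D n) :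
    Function.Surjective e := by
  have : NeZero m := ⟨by omega⟩
  rw [← Set.range_eq_univ]
  refine eq_univ_of_triangle_closed (by omega) ?_ (Set.mem_range_self .v₁)
    (Set.mem_range_self (cycA 0)) (e.map_adj_iff.2 (D_adj_v₁_cycA _))
  rintro _ _ u ⟨v, rfl⟩ ⟨w, rfl⟩ hvw hvu hwu
  obtain ⟨z, z', hz, -, hall⟩ := D_common_neighbors hm (e.map_adj_iff.1 hvw)
  obtain ⟨y, y', -, -, hall'⟩ := D_common_neighbors hn hvw
  have h1 := (hall z).2 (Or.inl rfl)
  have h2 := (hall z').2 (Or.inr rfl)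
  have h1' := (hall' (e z)).1 ⟨e.map_adj_iff.2 h1.1, e.map_adj_iff.2 h1.2⟩
  have h2' := (hall' (e z')).1 ⟨e.map_adj_iff.2 h2.1, e.map_adj_iff.2 h2.2⟩
  have hne := e.injective.ne hz
  have hu : u = e z ∨ u = e z' := by
    have := (hall' u).1 ⟨hvu, hwu⟩
    grind
  rcases hu with rfl | rfl
  exacts [⟨z, rfl⟩, ⟨z', rfl⟩]

end Triangles

/-! ### Models of the sentences -/

open FirstOrder FirstOrder.Language

theorem exists_K4_of_not_cliqueFree {V : Type*} {G : SimpleGraph V} (h : ¬ G.CliqueFree 4) :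
    ∃ x₁ x₂ x₃ x₄ : V, G.Adj x₁ x₂ ∧ G.Adj x₁ x₃ ∧ G.Adj x₁ x₄ ∧ G.Adj x₂ x₃ ∧ G.Adj x₂ x₄ ∧
      G.Adj x₃ x₄ := by
  obtain ⟨f⟩ := (SimpleGraph.not_cliqueFree_iff_top_isContained 4).1 h
  have hf : ∀ i j : Fin 4, i ≠ j → G.Adj (f i) (f j) := fun i j hij => f.toHom.map_adj hij
  exact ⟨f 0, f 1, f 2, f 3, hf _ _ (by decide), hf _ _ (by decide), hf _ _ (by decide),
    hf _ _ (by decide), hf _ _ (by decide), hf _ _ (by decide)⟩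

theorem models_phiHat_iff {V : Type u} (G : SimpleGraph V) :
    Models G phiHat ↔ Models G phi ∨ ¬ G.CliqueFree 4 := by
  rw [models_phiHat]
  refine or_congr Iff.rfl ⟨?_, exists_K4_of_not_cliqueFree⟩
  rintro ⟨x₁, x₂, x₃, x₄, h₁₂, h₁₃, h₁₄, h₂₃, h₂₄, h₃₄⟩ hG
  exact no_K4_of_cliqueFree hG h₁₂ h₁₃ h₁₄ h₂₃ h₂₄ h₃₄

/-- In a finite model of `φ` the choices of `c, d` for given `a, b` can be iterated until a pair
recurs; this closes up to a homomorphic image of some `D k`. -/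
theorem exists_hom_of_models_phi {V : Type u} [Finite V] {G : SimpleGraph V}
    (h : Models G phi) : ∃ k : ℕ, 4 ≤ k ∧ Nonempty (D k →g G) := by
  obtain ⟨x₁, x₂, y, z, hy, hyz, hz, hstep⟩ := (models_phi G).1 h
  let P := {p : V × V // G.Adj x₁ p.1 ∧ G.Adj p.1 p.2 ∧ G.Adj p.2 x₂}
  have hnext : ∀ p : P, ∃ q : P, G.Adj p.1.1 q.1.1 ∧ G.Adj p.1.2 q.1.1 ∧ G.Adj p.1.2 q.1.2 := by
    rintro ⟨⟨a, b⟩, hp⟩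
    obtain ⟨c, d, h₁c, hac, hbc, hbd, hcd, hd₂⟩ := hstep a b hp
    exact ⟨⟨(c, d), h₁c, hcd, hd₂⟩, hac, hbc, hbd⟩
  choose f hf using hnext
  let p : P := ⟨(y, z), hy, hyz, hz⟩
  obtain ⟨i, j, hij, heq⟩ : ∃ i j : ℕ, i < j ∧ f^[i] p = f^[j] p := by
    obtain ⟨i, j, hij, heq⟩ := Finite.exists_ne_map_eq_of_infinite (fun i : ℕ => f^[i] p)
    rcases lt_or_gt_of_ne hij with h | h
    exacts [⟨i, j, h, heq⟩, ⟨j, i, h, heq.symm⟩]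
  obtain ⟨q, k, hk, hq⟩ : ∃ (q : P) (k : ℕ), 0 < k ∧ f^[k] q = q := by
    refine ⟨f^[i] p, j - i, by omega, ?_⟩
    rw [← Function.iterate_add_apply, Nat.sub_add_cancel hij.le, heq]
  -- Four rounds make the length at least four.
  have hper : f^[k * 4] q = q := by
    rw [Function.iterate_mul]
    exact Function.iterate_fixed hq 4
  have hsucc : ∀ i j : ℕ, j = i + 1 → f^[j] q = f (f^[i] q) := by
    rintro i _ rfl
    exact Function.iterate_succ_apply' f i q
  have hclose : ∀ i j : ℕ, i = 0 → j + 1 = k * 4 → f^[i] q = f (f^[j] q) := by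
    rintro i j rfl hj
    rw [← hsucc j (k * 4) hj.symm, hper]
    rfl
  let g : DVertex (k * 4) → V := fun v => match v with
    | .v₁ => x₁
    | .v₂ => x₂
    | .a i => (f^[(i : ℕ)] q).1.1
    | .b i => (f^[(i : ℕ)] q).1.2
  have hedge : ∀ v w, DEdge (k * 4) v w → G.Adj (g v) (g w) := by
    intro v w hvw
    cases hvw with
    | va i => exact (f^[(i : ℕ)] q).2.1
    | vb i => exact (f^[(i : ℕ)] q).2.2.2.symm
    | ab i => exact (f^[(i : ℕ)] q).2.2.1
    | aa i j h => simp only [g, hsucc _ _ h]; exact (hf _).1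
    | bb i j h => simp only [g, hsucc _ _ h]; exact (hf _).2.2
    | ba i j h => simp only [g, hsucc _ _ h]; exact (hf _).2.1
    | aa_close i j hi hj => simp only [g, hclose _ _ hi hj]; exact (hf _).1.symm
    | bb_close i j hi hj => simp only [g, hclose _ _ hi hj]; exact (hf _).2.2.symm
    | ab_close i j hi hj => simp only [g, hclose _ _ hi hj]; exact (hf _).2.1.symm
  refine ⟨k * 4, by omega, ⟨⟨g, fun {v w} hvw => ?_⟩⟩⟩
  rcases ((SimpleGraph.fromRel_adj _ _ _).1 hvw).2 with h | h
  · exact hedge v w h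
  · exact (hedge w v h).symm

/-- A planar model of `φ` without `K₄` contains an induced copy of some `D m`. -/
theorem exists_embedding_of_models_phi {V : Type u} {G : SimpleGraph V} (hG : planarGraphs G)
    (h4 : G.CliqueFree 4) (h : Models G phi) : ∃ m : ℕ, 4 ≤ m ∧ Nonempty (D m ↪g G) := by
  have := hG.1
  obtain ⟨k, hk, ⟨f⟩⟩ := exists_hom_of_models_phi h
  obtain ⟨x₁, x₂, A, B, S⟩ := IsStrip.of_hom (by omega) f
  obtain ⟨m, hm, -, he⟩ := S.exists_embedding h4 hG.2.some.not_isMinor_top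
  exact ⟨m, hm, he⟩

/-- If `D n` maps homomorphically to a planar graph, then this graph is a model of `φ̂`: of `φ`,
unless it contains a `K₄`. -/
theorem models_phiHat_of_hom {n : ℕ} (hn : 2 ≤ n) {V : Type u} {G : SimpleGraph V}
    (hG : planarGraphs G) (f : D n →g G) : Models G phiHat := by
  rw [models_phiHat_iff]
  by_cases h4 : G.CliqueFree 4
  · obtain ⟨x₁, x₂, A, B, S⟩ := IsStrip.of_hom hn f
    exact Or.inl (S.models_phi h4 hG.2.some.not_isMinor_top)
  · exact Or.inr h4

theorem preservedByHoms_phiHat : PreservedByHoms planarGraphs.{u} phiHat := by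
  intro V W G H hG hH ⟨f⟩ hφ
  rcases (models_phiHat G).1 hφ with h | ⟨x₁, x₂, x₃, x₄, h₁₂, h₁₃, h₁₄, h₂₃, h₂₄, h₃₄⟩
  · have := hG.1
    obtain ⟨k, hk, ⟨g⟩⟩ := exists_hom_of_models_phi h
    exact models_phiHat_of_hom (by omega) hH (f.comp g)
  · exact (models_phiHat H).2 (Or.inr ⟨f x₁, f x₂, f x₃, f x₄, f.map_adj h₁₂, f.map_adj h₁₃,
      f.map_adj h₁₄, f.map_adj h₂₃, f.map_adj h₂₄, f.map_adj h₃₄⟩)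

/-! ### Minimal induced models -/

theorem planarGraphs_induce {V : Type u} {G : SimpleGraph V} (hG : planarGraphs G) (S : Set V) :
    planarGraphs (G.induce S) :=
  planarGraphs_of_hom hG (SimpleGraph.Embedding.induce S).toHom Subtype.val_injective

/-- A graph embedding, with its range as codomain. -/
def rangeHom {V W : Type*} {G : SimpleGraph V} {H : SimpleGraph W} (e : G ↪g H) :
    G →g H.induce (Set.range e) where
  toFun v := ⟨e v, v, rfl⟩
  map_rel' h := e.map_adj_iff.2 h

theorem nonempty_iso_of_surjective {V W : Type*} {G : SimpleGraph V} {H : SimpleGraph W}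
    (e : G ↪g H) (he : Function.Surjective e) : Nonempty (H ≃g G) :=
  ⟨(RelIso.ofSurjective e he).symm⟩

theorem isMinimalInducedModel_of_iso_D {V : Type u} {G : SimpleGraph V} {n : ℕ} (hn : 4 ≤ n)
    (e : G ≃g D n) : IsMinimalInducedModel planarGraphs phiHat G := by
  have hG : planarGraphs G := planarGraphs_of_hom (planarGraphs_D (by omega)) e.toHom e.injective
  refine ⟨hG, models_phiHat_of_hom (by omega) hG e.symm.toHom, fun S hS hSG hφ => hS ?_⟩
  let ι : G.induce S ↪g D n := e.toEmbedding.comp (SimpleGraph.Embedding.induce S)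
  have h4 : (G.induce S).CliqueFree 4 := (cliqueFree_D hn).comap ι.isContained
  rcases (models_phiHat_iff _).1 hφ with h | h
  · obtain ⟨m, hm, ⟨f⟩⟩ := exists_embedding_of_models_phi hSG h4 h
    have hsurj := embedding_surjective hm hn (ι.comp f)
    rw [Set.eq_univ_iff_forall]
    intro x
    obtain ⟨v, hv⟩ := hsurj (e x)
    have : ((f v : S) : V) = x := e.injective hv
    exact this ▸ (f v).2
  · exact absurd h4 h

theorem isMinimalInducedModel_of_iso_K4 {V : Type u} {G : SimpleGraph V}
    (e : G ≃g (⊤ : SimpleGraph (Fin 4))) : IsMinimalInducedModel planarGraphs phiHat G := by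
  have hG : planarGraphs G := planarGraphs_of_hom planarGraphs_K4 e.toHom e.injective
  have hmodel : Models G phiHat := by
    rw [models_phiHat_iff]
    refine Or.inr fun h => ?_
    have hadj : ∀ i j : Fin 4, i ≠ j → G.Adj (e.symm i) (e.symm j) := fun i j hij =>
      e.symm.map_adj_iff.2 hij
    exact no_K4_of_cliqueFree h (hadj 0 1 (by decide)) (hadj 0 2 (by decide))
      (hadj 0 3 (by decide)) (hadj 1 2 (by decide)) (hadj 1 3 (by decide)) (hadj 2 3 (by decide))
  refine ⟨hG, hmodel, fun S hS hSG hφ => hS ?_⟩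
  let ι : S → Fin 4 := fun x => e x
  have hι : Function.Injective ι := e.injective.comp Subtype.val_injective
  by_cases h4 : (G.induce S).CliqueFree 4
  · rcases (models_phiHat_iff _).1 hφ with h | h
    · obtain ⟨m, hm, ⟨f⟩⟩ := exists_embedding_of_models_phi hSG h4 h
      have hcard := Nat.card_le_card_of_injective _ (hι.comp f.injective)
      rw [card_DVertex, Nat.card_fin] at hcard
      omega
    · exact absurd h4 h
  · obtain ⟨f⟩ := (SimpleGraph.not_cliqueFree_iff_top_isContained 4).1 h4
    have hsurj := Finite.surjective_of_injective (hι.comp f.injective)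
    rw [Set.eq_univ_iff_forall]
    intro x
    obtain ⟨i, hi⟩ := hsurj (e x)
    have : ((f i : S) : V) = x := e.injective hi
    exact this ▸ (f i).2

theorem iso_of_isMinimalInducedModel {V : Type u} {G : SimpleGraph V}
    (h : IsMinimalInducedModel planarGraphs phiHat G) :
    Nonempty (G ≃g (⊤ : SimpleGraph (Fin 4))) ∨ ∃ n : ℕ, 4 ≤ n ∧ Nonempty (G ≃g D n) := by
  obtain ⟨hG, hφ, hmin⟩ := h
  by_cases h4 : G.CliqueFree 4
  · right
    have hphi := ((models_phiHat_iff G).1 hφ).resolve_right (not_not.2 h4)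
    obtain ⟨m, hm, ⟨e⟩⟩ := exists_embedding_of_models_phi hG h4 hphi
    refine ⟨m, hm, nonempty_iso_of_surjective e ?_⟩
    by_contra hsurj
    have hS := planarGraphs_induce hG (Set.range e)
    exact hmin _ (fun h => hsurj (Set.range_eq_univ.1 h)) hS
      (models_phiHat_of_hom (by omega) hS (rangeHom e))
  · left
    obtain ⟨e⟩ : Nonempty ((⊤ : SimpleGraph (Fin 4)) ↪g G) :=
      ⟨SimpleGraph.topEmbeddingOfNotCliqueFree h4⟩
    refine nonempty_iso_of_surjective e ?_
    by_contra hsurj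
    refine hmin _ (fun h => hsurj (Set.range_eq_univ.1 h)) (planarGraphs_induce hG (Set.range e)) ?_
    rw [models_phiHat_iff]
    refine Or.inr (SimpleGraph.IsContained.not_cliqueFree ⟨⟨rangeHom e, fun i j hij => ?_⟩⟩)
    exact e.injective (congrArg Subtype.val hij)

/-! ### Existential sentences and the failure of preservation -/

/-- The inclusion of an induced subgraph, as an embedding of structures. -/
def inducedEmbedding {V : Type u} (G : SimpleGraph V) (U : Set V) :
    @Language.Embedding Language.graph U V (G.induce U).structure G.structure :=
  letI := (G.induce U).structure
  letI := G.structure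
  { toFun := Subtype.val
    inj' := Subtype.val_injective
    map_fun' := fun f => isEmptyElim f
    map_rel' := by
      rintro _ ⟨⟩ x
      exact Iff.rfl }

/-- The formula `ψ` has witnesses of bounded number: whenever it holds in a graph, some `k`
vertices are such that it holds already in every induced subgraph that contains them (and the
values of the free variables). -/
def HasBoundedWitnesses {n : ℕ} (ψ : Language.graph.BoundedFormula Empty n) : Prop :=
  ∃ k : ℕ, ∀ ⦃V : Type u⦄ (G : SimpleGraph V) (v : Empty → V) (xs : Fin n → V),
    @BoundedFormula.Realize _ V G.structure _ _ ψ v xs →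
    ∃ T : Finset V, T.card ≤ k ∧ ∀ U : Set V, (T : Set V) ⊆ U →
      ∀ (w : Empty → U) (ys : Fin n → U), (fun i => (ys i : V)) = xs →
        @BoundedFormula.Realize _ U (G.induce U).structure _ _ ψ w ys

theorem HasBoundedWitnesses.of_isQF {n : ℕ} {ψ : Language.graph.BoundedFormula Empty n}
    (h : ψ.IsQF) : HasBoundedWitnesses.{u} ψ := by
  refine ⟨0, fun V G v xs hψ => ⟨∅, le_rfl, fun U _ w ys hys => ?_⟩⟩
  let _ := (G.induce U).structure
  let _ := G.structure
  refine (h.realize_embedding (inducedEmbedding G U)).1 ?_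
  rw [Subsingleton.elim (inducedEmbedding G U ∘ w) v]
  have : inducedEmbedding G U ∘ ys = xs := hys
  rwa [this]

theorem HasBoundedWitnesses.inf {n : ℕ} {φ ψ : Language.graph.BoundedFormula Empty n}
    (hφ : HasBoundedWitnesses.{u} φ) (hψ : HasBoundedWitnesses.{u} ψ) :
    HasBoundedWitnesses.{u} (φ ⊓ ψ) := by
  classical
  obtain ⟨k, hk⟩ := hφ
  obtain ⟨l, hl⟩ := hψ
  refine ⟨k + l, fun V G v xs h => ?_⟩
  let _ := G.structure
  rw [BoundedFormula.realize_inf] at h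
  obtain ⟨T, hT, hTU⟩ := hk G v xs h.1
  obtain ⟨T', hT', hTU'⟩ := hl G v xs h.2
  refine ⟨T ∪ T', (Finset.card_union_le _ _).trans (add_le_add hT hT'), fun U hU w ys hys => ?_⟩
  rw [Finset.coe_union, Set.union_subset_iff] at hU
  let _ := (G.induce U).structure
  rw [BoundedFormula.realize_inf]
  exact ⟨hTU U hU.1 w ys hys, hTU' U hU.2 w ys hys⟩

theorem HasBoundedWitnesses.sup {n : ℕ} {φ ψ : Language.graph.BoundedFormula Empty n}
    (hφ : HasBoundedWitnesses.{u} φ) (hψ : HasBoundedWitnesses.{u} ψ) :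
    HasBoundedWitnesses.{u} (φ ⊔ ψ) := by
  obtain ⟨k, hk⟩ := hφ
  obtain ⟨l, hl⟩ := hψ
  refine ⟨k + l, fun V G v xs h => ?_⟩
  let _ := G.structure
  rw [BoundedFormula.realize_sup] at h
  rcases h with h | h
  · obtain ⟨T, hT, hTU⟩ := hk G v xs h
    refine ⟨T, hT.trans (Nat.le_add_right _ _), fun U hU w ys hys => ?_⟩
    let _ := (G.induce U).structure
    exact BoundedFormula.realize_sup.2 (Or.inl (hTU U hU w ys hys))
  · obtain ⟨T, hT, hTU⟩ := hl G v xs h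
    refine ⟨T, hT.trans (Nat.le_add_left _ _), fun U hU w ys hys => ?_⟩
    let _ := (G.induce U).structure
    exact BoundedFormula.realize_sup.2 (Or.inr (hTU U hU w ys hys))

theorem HasBoundedWitnesses.ex {n : ℕ} {ψ : Language.graph.BoundedFormula Empty (n + 1)}
    (hψ : HasBoundedWitnesses.{u} ψ) : HasBoundedWitnesses.{u} ψ.ex := by
  classical
  obtain ⟨k, hk⟩ := hψ
  refine ⟨k + 1, fun V G v xs h => ?_⟩
  let _ := G.structure
  rw [BoundedFormula.realize_ex] at h
  obtain ⟨a, ha⟩ := h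
  obtain ⟨T, hT, hTU⟩ := hk G v _ ha
  refine ⟨insert a T, (Finset.card_insert_le _ _).trans (Nat.succ_le_succ hT),
    fun U hU w ys hys => ?_⟩
  rw [Finset.coe_insert, Set.insert_subset_iff] at hU
  let _ := (G.induce U).structure
  rw [BoundedFormula.realize_ex]
  refine ⟨⟨a, hU.1⟩, hTU U hU.2 w _ ?_⟩
  subst hys
  exact Fin.comp_snoc (g := (Subtype.val : U → V)) ys ⟨a, hU.1⟩

theorem HasBoundedWitnesses.of_isExistential {n : ℕ}
    {ψ : Language.graph.BoundedFormula Empty n} (h : ψ.IsExistential) :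
    HasBoundedWitnesses.{u} ψ := by
  induction h with
  | of_isQF h => exact .of_isQF h
  | ex _ ih => exact ih.ex

theorem HasBoundedWitnesses.of_isExistentialPositive {n : ℕ}
    {ψ : Language.graph.BoundedFormula Empty n} (h : IsExistentialPositive ψ) :
    HasBoundedWitnesses.{u} ψ := by
  induction h with
  | top => exact .of_isQF BoundedFormula.IsQF.top
  | bot => exact .of_isQF BoundedFormula.isQF_bot
  | atom h => exact .of_isQF h.isQF
  | inf _ _ ih₁ ih₂ => exact ih₁.inf ih₂
  | sup _ _ ih₁ ih₂ => exact ih₁.sup ih₂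
  | ex _ ih => exact ih.ex

/-- The minimal models `D n` of `φ̂` are arbitrarily large, so boundedly many witnesses never
suffice. -/
theorem not_equivalentOver_phiHat {ψ : Language.graph.Sentence}
    (h : HasBoundedWitnesses.{u} (n := 0) ψ) : ¬ EquivalentOver planarGraphs.{u} phiHat ψ := by
  intro heq
  obtain ⟨k, hk⟩ := h
  let G : SimpleGraph (ULift.{u} (DVertex (k + 4))) := (D (k + 4)).comap Equiv.ulift
  have e : G ≃g D (k + 4) := SimpleGraph.Iso.comap Equiv.ulift (D (k + 4))
  obtain ⟨hG, hφ, hmin⟩ := isMinimalInducedModel_of_iso_D (Nat.le_add_left 4 k) e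
  obtain ⟨T, hT, hTU⟩ := hk G _ _ ((heq G hG).1 hφ)
  have hS := planarGraphs_induce hG (T : Set _)
  refine hmin T (fun huniv => ?_) hS ((heq _ hS).2
    (hTU T subset_rfl _ _ (Subsingleton.elim _ _)))
  have hcard : Nat.card (DVertex (k + 4)) ≤ k := by
    rw [← Nat.card_congr (Equiv.ulift.{u}), ← Set.ncard_univ, ← huniv, Set.ncard_coe_finset]
    exact hT
  rw [card_DVertex] at hcard
  omega

theorem D_injective {m n : ℕ} (h : Nonempty (D m ≃g D n)) : m = n := by
  obtain ⟨e⟩ := h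
  have := Nat.card_congr e.toEquiv
  rw [card_DVertex, card_DVertex] at this
  omega

theorem preservedByExtensions_of_preservedByHoms {C : GraphClass.{u}}
    {φ : Language.graph.Sentence} (h : PreservedByHoms C φ) : PreservedByExtensions C φ :=
  fun _ _ G H hG hH ⟨e⟩ => h G H hG hH ⟨e.toHom⟩

end PlanarHPP

theorem mainTheorem3 :
    -- the sentence `φ̂` is preserved by homomorphisms among finite planar graphs,
    PlanarHPP.PreservedByHoms PlanarHPP.planarGraphs.{u} PlanarHPP.phiHat ∧
    -- but it is equivalent to no existential-positive sentence there;
    (∀ ψ : FirstOrder.Language.graph.Sentence, PlanarHPP.IsExistentialPositive ψ →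
      ¬ PlanarHPP.EquivalentOver PlanarHPP.planarGraphs.{u} PlanarHPP.phiHat ψ) ∧
    -- hence homomorphism preservation and extension preservation fail on finite planar graphs.
    ¬ PlanarHPP.HasHomPreservation PlanarHPP.planarGraphs.{u} ∧
    ¬ PlanarHPP.HasExtPreservation PlanarHPP.planarGraphs.{u} ∧
    -- If a graph `H` without `K₄` and without a `K₅`-minor receives a homomorphism from `D n`,
    -- then `H` has an induced subgraph isomorphic to `D m` for some `m ∣ n`.
    (∀ n : ℕ, 4 ≤ n → ∀ (V : Type u) (H : SimpleGraph V), H.CliqueFree 4 →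
      ¬ PlanarHPP.IsMinor (⊤ : SimpleGraph (Fin 5)) H → Nonempty (PlanarHPP.D n →g H) →
      ∃ m : ℕ, 4 ≤ m ∧ m ∣ n ∧ Nonempty (PlanarHPP.D m ↪g H)) ∧
    -- The minimal induced models of `φ̂` are `K₄` and the graphs `D n` with `n ≥ 4`,
    (∀ (V : Type u) (G : SimpleGraph V),
      PlanarHPP.IsMinimalInducedModel PlanarHPP.planarGraphs.{u} PlanarHPP.phiHat G ↔
        Nonempty (G ≃g (⊤ : SimpleGraph (Fin 4))) ∨
          ∃ n : ℕ, 4 ≤ n ∧ Nonempty (G ≃g PlanarHPP.D n)) ∧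
    -- and no two of the latter are isomorphic.
    (∀ m n : ℕ, 4 ≤ m → 4 ≤ n → Nonempty (PlanarHPP.D m ≃g PlanarHPP.D n) → m = n) := by
  refine ⟨PlanarHPP.preservedByHoms_phiHat, fun ψ hψ =>
    PlanarHPP.not_equivalentOver_phiHat (.of_isExistentialPositive hψ), fun h => ?_, fun h => ?_,
    fun n hn V H h4 h5 hf => ?_, fun V G => ⟨PlanarHPP.iso_of_isMinimalInducedModel, ?_⟩,
    fun m n _ _ => PlanarHPP.D_injective⟩
  · obtain ⟨ψ, hψ, heq⟩ := h _ PlanarHPP.preservedByHoms_phiHat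
    exact PlanarHPP.not_equivalentOver_phiHat (.of_isExistentialPositive hψ) heq
  · obtain ⟨ψ, hψ, heq⟩ := h _ (PlanarHPP.preservedByExtensions_of_preservedByHoms
      PlanarHPP.preservedByHoms_phiHat)
    exact PlanarHPP.not_equivalentOver_phiHat (.of_isExistential hψ) heq
  · obtain ⟨f⟩ := hf
    obtain ⟨x₁, x₂, A, B, S⟩ := PlanarHPP.IsStrip.of_hom (by omega) f
    exact S.exists_embedding h4 h5
  · rintro (⟨⟨e⟩⟩ | ⟨n, hn, ⟨e⟩⟩)
    · exact PlanarHPP.isMinimalInducedModel_of_iso_K4 e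
    · exact PlanarHPP.isMinimalInducedModel_of_iso_D hn e
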